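/- Fix a countably infinite supply of symbols. An alphabet is a finite set of symbols. A language class $\mathcal{C}$ is given by a (not necessarily decidable) set of representations, each consisting of an explicitly given alphabet $X$ and a code, and denoting a language $L\subseteq X^*$; the members of $\mathcal{C}$ are the languages that have a representation. A transducer has finitely many states, one of them initial and some of them final, and finitely many edges, each reading a word and writing a word; its rational transduction is the set $T$ of pairs $(u,v)$ such that some path from the initial state to a final state reads $u$ and writes $v$, and $TL=\{v \mid \exists u\in L\colon (u,v)\in T\}$. The class $\mathcal{C}$ is a \emph{full trio} if it is effectively closed under rational transductions: there is an algorithm that, given a transducer for $T$ and a representation of some $L\in\mathcal{C}$, computes a representation in $\mathcal{C}$ of $TL$. The downward closure of a language $L$ is $L{\downarrow}=\{u \mid \exists v\in L\colon u \text{ is a (scattered) subword of } v\}$. Downward closures are \emph{computable} for $\mathcal{C}$ if there is an algorithm that, given a representation of $L\in\mathcal{C}$, computes a finite automaton accepting $L{\downarrow}$. The \emph{simultaneous unboundedness problem} (SUP) for $\mathcal{C}$ is the following decision problem: given pairwise distinct symbols $a_1,\dots,a_n$ ($n\ge 0$) and a representation of a language $L\in\mathcal{C}$ with $L\subseteq a_1^*\cdots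 a_n^*$, does $L{\downarrow}=a_1^*\cdots a_n^*$ hold? (The inclusion $L\subseteq a_1^*\cdots a_n^*$ is a promise: a decision procedure has to terminate with the correct answer only on inputs that satisfy it.) **Theorem.** Let $\mathcal{C}$ be a full trio. Then downward closures are computable for $\mathcal{C}$ if and only if the SUP is decidable for $\mathcal{C}$. -/

import Mathlib

namespace DownwardClosures

/-! Symbols are natural numbers, an alphabet is a finite list of symbols (order and repetitions
are irrelevant), words are lists of symbols, languages are sets of words. -/

/-- A language class together with its system of representations. A representation is a pair
`(X, c)` of an alphabet `X` and a code `c` (a Gödel number of, say, a grammar or an automaton).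
`rep` is the set of valid representations, which need not be decidable, and a valid representation
`r = (X, c)` denotes the language `lang r ⊆ X^*`. The class consists of the languages `lang r`
with `r ∈ rep`; the value of `lang` outside of `rep` plays no role. -/
structure LanguageClass where
  rep : Set (List ℕ × ℕ)
  lang : List ℕ × ℕ → Language ℕ
  lang_over : ∀ r ∈ rep, ∀ w ∈ lang r, ∀ a ∈ w, a ∈ r.1

/-- The downward closure with respect to the scattered subword ordering. -/
def downwardClosure (L : Language ℕ) : Language ℕ :=
  {u | ∃ v ∈ L, List.Sublist u v}

/-- A finite automaton `(E, q₀, F)`: a finite list of edges `(p, w, q)` labeled by words, an initial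
state and a finite list of final states. The state set and the input alphabet are the (finite) sets
of the states and of the symbols that occur. -/
abbrev FiniteAutomaton := List (ℕ × List ℕ × ℕ) × ℕ × List ℕ

/-- `AutPath E p w q`: the edges in `E` admit a path from `p` to `q` labeled `w`. -/
inductive AutPath (E : List (ℕ × List ℕ × ℕ)) : ℕ → List ℕ → ℕ → Prop
  | nil (p : ℕ) : AutPath E p [] p
  | cons {p q s : ℕ} {u w : List ℕ} :
      (p, u, q) ∈ E → AutPath E q w s → AutPath E p (u ++ w) s

/-- The language accepted by a finite automaton. -/
def FiniteAutomaton.accepts (A : FiniteAutomaton) : Language ℕ :=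
  {w | ∃ f ∈ A.2.2, AutPath A.1 A.2.1 w f}

/-- A finite-state transducer `(E, q₀, F)`: a finite list of edges `(p, u, v, q)`, reading the word
`u` and writing the word `v`, an initial state and a finite list of final states. The state set and
the input and output alphabets are the (finite) sets of the states and symbols that occur. -/
abbrev Transducer := List (ℕ × List ℕ × List ℕ × ℕ) × ℕ × List ℕ

/-- `TransPath E p u v q`: the edges in `E` admit a path from `p` to `q` that reads `u` and
writes `v`. -/
inductive TransPath (E : List (ℕ × List ℕ × List ℕ × ℕ)) :
    ℕ → List ℕ → List ℕ → ℕ → Prop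
  | nil (p : ℕ) : TransPath E p [] [] p
  | cons {p q s : ℕ} {u v u' v' : List ℕ} :
      (p, u, v, q) ∈ E → TransPath E q u' v' s → TransPath E p (u ++ u') (v ++ v') s

/-- The (rational) transduction generated by a transducer. -/
def Transducer.transduction (A : Transducer) : Set (List ℕ × List ℕ) :=
  {x | ∃ f ∈ A.2.2, TransPath A.1 A.2.1 x.1 x.2 f}

/-- The image `T L` of a language under a transduction. -/
def image (T : Set (List ℕ × List ℕ)) (L : Language ℕ) : Language ℕ :=
  {v | ∃ u ∈ L, (u, v) ∈ T}

/-- Effective closure under rational transductions: there is an algorithm that, given a transducer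
for `T` and a representation of `L`, terminates with a representation of `T L` in the class. -/
def LanguageClass.IsFullTrio (C : LanguageClass) : Prop :=
  ∃ f : Transducer × (List ℕ × ℕ) →. List ℕ × ℕ, Partrec f ∧
    ∀ (A : Transducer), ∀ r ∈ C.rep,
      ∃ r' ∈ f (A, r), r' ∈ C.rep ∧ C.lang r' = image A.transduction (C.lang r)

/-- Downward closures are computable: there is an algorithm that, given a representation of `L`,
terminates with a finite automaton for the downward closure of `L`. -/
def LanguageClass.DownwardClosuresComputable (C : LanguageClass) : Prop :=
  ∃ f : List ℕ × ℕ →. FiniteAutomaton, Partrec f ∧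
    ∀ r ∈ C.rep, ∃ A ∈ f r, A.accepts = downwardClosure (C.lang r)

open scoped Computability in
/-- The language `a₁^* ⋯ aₙ^*`, where `as = [a₁, …, aₙ]`. -/
def boundedStar (as : List ℕ) : Language ℕ :=
  (as.map fun a => ({[a]} : Language ℕ)∗).prod

/-- The simultaneous unboundedness problem is decidable: there is an algorithm that, given distinct
symbols `a₁, …, aₙ` and a representation of a language `L ⊆ a₁^* ⋯ aₙ^*` in the class, terminates
with the answer to whether the downward closure of `L` equals `a₁^* ⋯ aₙ^*`. Nothing is required
of the algorithm on other inputs. -/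
def LanguageClass.SUPDecidable (C : LanguageClass) : Prop :=
  ∃ f : List ℕ × (List ℕ × ℕ) →. Bool, Partrec f ∧
    ∀ (as : List ℕ), ∀ r ∈ C.rep, as.Nodup → C.lang r ≤ boundedStar as →
      ∃ b ∈ f (as, r), (b = true ↔ downwardClosure (C.lang r) = boundedStar as)

end DownwardClosures

namespace DownwardClosures

/-! ### Recursively enumerable predicates, presented by monotone primitive recursive stages -/

-- Both directions reduce to searching for a finite witness. Relations built from primitive
-- recursive tests by conjunction, disjunction, existential quantification and universal
-- quantification over computed lists are `Enumerable`, and `Enumerable.exists_partrec` turns such a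
-- relation into a partial algorithm that halts with a related value whenever there is one. The
-- given procedures may diverge or err on invalid inputs without harm.
--
-- From the SUP to downward closures: let D be the downward closure of L, over the alphabet X. By
-- Higman's lemma, D is a finite union of ideals (`IsDownwardClosedOver.exists_ideals`), and
-- finitely many words generate its complement in X^* (`exists_forbidden`). Whether an ideal,
-- generated by the words Y₁^k z₁ ⋯ Yₙ^k zₙ, lies in D can be decided: D is an image of L under a
-- transduction, and a second one maps D to the words a₁^{k₁} ⋯ aₙ^{kₙ} with Y₁^{k₁} z₁ ⋯ Yₙ^{kₙ} zₙ
-- in D. This is a SUP instance whose answer is yes exactly if the ideal is included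
-- (`IdealExpr.lang_subset_iff_image`). So one searches for ideals inside D, words outside D, and an
-- automaton with a locally checkable proof that accepted words lie in one of the ideals and that
-- all other words over X contain one of the excluded words. Such data force the automaton to accept
-- D (`Certificate.accepts_eq`), and they exist (`exists_certificate`).
--
-- From downward closures to the SUP: under the promise, the question is whether the automaton for D
-- accepts a₁^k ⋯ aₙ^k for all k. If so, loops that read a₁, …, aₙ can be found in turn along an
-- accepting path (`pumpable_iff`); if not, finitely many configurations refute some k
-- (`blockRejected_iff`). Both kinds of witness are searched for in parallel.

attribute [fun_prop] Primrec
attribute [fun_prop] Primrec.comp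

/-! ### Composition rules for primitive recursive functions and predicates -/

section PrimrecFunProp
variable {α β γ : Type*} [Primcodable α] [Primcodable β] [Primcodable γ]

@[fun_prop] theorem primrec_id : Primrec fun a : α => a := Primrec.id
@[fun_prop] theorem primrec_const (b : β) : Primrec fun _ : α => b := Primrec.const b
@[fun_prop] theorem primrec_fst {f : α → β × γ} (hf : Primrec f) : Primrec fun a => (f a).1 :=
  Primrec.fst.comp hf
@[fun_prop] theorem primrec_snd {f : α → β × γ} (hf : Primrec f) : Primrec fun a => (f a).2 :=
  Primrec.snd.comp hf
@[fun_prop] theorem primrec_mk {f : α → β} {g : α → γ} (hf : Primrec f) (hg : Primrec g) :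
    Primrec fun a => (f a, g a) := Primrec.pair hf hg
@[fun_prop] theorem primrec_cons {f : α → β} {g : α → List β} (hf : Primrec f) (hg : Primrec g) :
    Primrec fun a => f a :: g a := Primrec.list_cons.comp hf hg
@[fun_prop] theorem primrec_append {f g : α → List β} (hf : Primrec f) (hg : Primrec g) :
    Primrec fun a => f a ++ g a := Primrec.list_append.comp hf hg
@[fun_prop] theorem primrec_length {f : α → List β} (hf : Primrec f) :
    Primrec fun a => (f a).length := Primrec.list_length.comp hf
@[fun_prop] theorem primrec_succ {f : α → ℕ} (hf : Primrec f) :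
    Primrec fun a => f a + 1 := Primrec.succ.comp hf
@[fun_prop] theorem primrec_some {f : α → β} (hf : Primrec f) :
    Primrec fun a => some (f a) := Primrec.option_some.comp hf
@[fun_prop] theorem primrec_toList {f : α → Option β} (hf : Primrec f) :
    Primrec fun a => (f a).toList := Primrec.optionToList.comp hf
@[fun_prop] theorem primrec_encode {f : α → β} (hf : Primrec f) :
    Primrec fun a => Encodable.encode (f a) := Primrec.encode.comp hf
@[fun_prop] theorem primrec_range {f : α → ℕ} (hf : Primrec f) :
    Primrec fun a => List.range (f a) := Primrec.list_range.comp hf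
@[fun_prop] theorem primrec_getElem? {f : α → List β} {g : α → ℕ} (hf : Primrec f)
    (hg : Primrec g) : Primrec fun a => (f a)[g a]? := Primrec.list_getElem?.comp hf hg
@[fun_prop] theorem primrec_map {f : α → List β} {g : α → β → γ} (hf : Primrec f)
    (hg : Primrec fun x : α × β => g x.1 x.2) : Primrec fun a => (f a).map (g a) :=
  Primrec.list_map hf hg

theorem primrecPred_eq {f g : α → β} (hf : Primrec f) (hg : Primrec g) :
    PrimrecPred fun a => f a = g a := Primrec.eq.comp hf hg

theorem primrecPred_ne {f g : α → β} (hf : Primrec f) (hg : Primrec g) :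
    PrimrecPred fun a => f a ≠ g a := (primrecPred_eq hf hg).not

theorem primrecPred_mem {f : α → β} {g : α → List β} (hf : Primrec f) (hg : Primrec g) :
    PrimrecPred fun a => f a ∈ g a := by
  have : PrimrecRel fun (L : List β) (b : β) => ∃ a ∈ L, a = b :=
    PrimrecRel.exists_mem_list Primrec.eq
  refine (this.comp hg hf).of_eq fun a => ?_
  simp

theorem primrecPred_forall_mem {f : α → List β} {p : α → β → Prop} (hf : Primrec f)
    (hp : PrimrecPred fun x : α × β => p x.1 x.2) : PrimrecPred fun a => ∀ b ∈ f a, p a b := by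
  have h : PrimrecRel fun (b : β) (a : α) => p a b :=
    hp.comp (f := fun x : β × α => (x.2, x.1)) (by fun_prop)
  exact (PrimrecRel.forall_mem_list h).comp hf Primrec.id

theorem primrecPred_exists_mem {f : α → List β} {p : α → β → Prop} (hf : Primrec f)
    (hp : PrimrecPred fun x : α × β => p x.1 x.2) : PrimrecPred fun a => ∃ b ∈ f a, p a b := by
  have h : PrimrecRel fun (b : β) (a : α) => p a b :=
    hp.comp (f := fun x : β × α => (x.2, x.1)) (by fun_prop)
  exact (PrimrecRel.exists_mem_list h).comp hf Primrec.id

end PrimrecFunProp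

/-- `p` is the union of an increasing sequence of uniformly primitive recursive stages. -/
def Enumerable {α : Type*} [Primcodable α] (p : α → Prop) : Prop :=
  ∃ q : α → ℕ → Prop, (PrimrecPred fun x : α × ℕ => q x.1 x.2) ∧
    (∀ a m n, m ≤ n → q a m → q a n) ∧ ∀ a, p a ↔ ∃ n, q a n

namespace Enumerable
variable {α β : Type*} [Primcodable α] [Primcodable β]

theorem of_eq {p q : α → Prop} (hp : Enumerable p) (h : ∀ a, p a ↔ q a) : Enumerable q := by
  obtain rfl : p = q := funext fun a => propext (h a)
  exact hp

theorem of_primrec {p : α → Prop} (hp : PrimrecPred p) : Enumerable p :=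
  ⟨fun a _ => p a, hp.comp Primrec.fst, fun _ _ _ _ h => h, fun a => by simp⟩

theorem comp {p : β → Prop} {f : α → β} (hp : Enumerable p) (hf : Primrec f) :
    Enumerable fun a => p (f a) := by
  obtain ⟨q, hq, hm, h⟩ := hp
  exact ⟨fun a n => q (f a) n, hq.comp (f := fun x : α × ℕ => (f x.1, x.2)) (by fun_prop),
    fun a => hm (f a), fun a => h (f a)⟩

theorem and {p q : α → Prop} (hp : Enumerable p) (hq : Enumerable q) :
    Enumerable fun a => p a ∧ q a := by
  obtain ⟨p', hp', hpm, h₁⟩ := hp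
  obtain ⟨q', hq', hqm, h₂⟩ := hq
  refine ⟨fun a n => p' a n ∧ q' a n, hp'.and hq',
    fun a m n hmn h => ⟨hpm a m n hmn h.1, hqm a m n hmn h.2⟩, fun a => ?_⟩
  dsimp only
  rw [h₁, h₂]
  constructor
  · rintro ⟨⟨m, hm⟩, n, hn⟩
    exact ⟨max m n, hpm a _ _ (le_max_left _ _) hm, hqm a _ _ (le_max_right _ _) hn⟩
  · rintro ⟨n, hm, hn⟩
    exact ⟨⟨n, hm⟩, n, hn⟩

theorem or {p q : α → Prop} (hp : Enumerable p) (hq : Enumerable q) :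
    Enumerable fun a => p a ∨ q a := by
  obtain ⟨p', hp', hpm, h₁⟩ := hp
  obtain ⟨q', hq', hqm, h₂⟩ := hq
  refine ⟨fun a n => p' a n ∨ q' a n, hp'.or hq',
    fun a m n hmn h => h.imp (hpm a m n hmn) (hqm a m n hmn), fun a => ?_⟩
  dsimp only
  rw [h₁, h₂, exists_or]

theorem ex {p : α → β → Prop} (hp : Enumerable fun x : α × β => p x.1 x.2) :
    Enumerable fun a => ∃ b, p a b := by
  obtain ⟨q, hq, hm, h⟩ := hp
  -- The stage `n` bounds both the code of the witness and the stage at which the witness is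
  -- confirmed.
  refine ⟨fun a n => ∃ m ∈ List.range n, ∃ b ∈ (Encodable.decode (α := β) m).toList, q (a, b) n, ?_, ?_, ?_⟩
  · refine primrecPred_exists_mem (by fun_prop) (primrecPred_exists_mem ?_ ?_)
    · exact Primrec.optionToList.comp (Primrec.decode.comp Primrec.snd)
    · exact hq.comp (f := fun x : ((α × ℕ) × ℕ) × β => ((x.1.1.1, x.2), x.1.1.2)) (by fun_prop)
  · rintro a m n hmn ⟨k, hk, b, hb, hq⟩
    exact ⟨k, by simp at hk ⊢; omega, b, hb, hm _ _ _ hmn hq⟩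
  · intro a
    constructor
    · rintro ⟨b, hb⟩
      obtain ⟨n, hn⟩ := (h (a, b)).1 hb
      exact ⟨max n (Encodable.encode b + 1), Encodable.encode b, by simp, b, by simp,
        hm _ _ _ (le_max_left _ _) hn⟩
    · rintro ⟨n, m, -, b, -, hb⟩
      exact ⟨b, (h (a, b)).2 ⟨n, hb⟩⟩

/-- Each of the finitely many elements is confirmed at some stage. Since stages increase, the
maximum of these confirms all of them. -/
theorem forall_mem {l : α → List β} {p : α → β → Prop} (hl : Primrec l)
    (hp : Enumerable fun x : α × β => p x.1 x.2) : Enumerable fun a => ∀ b ∈ l a, p a b := by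
  obtain ⟨q, hq, hm, h⟩ := hp
  refine ⟨fun a n => ∀ b ∈ l a, q (a, b) n, ?_, ?_, ?_⟩
  · refine primrecPred_forall_mem (by fun_prop) ?_
    exact hq.comp (f := fun y : (α × ℕ) × β => ((y.1.1, y.2), y.1.2)) (by fun_prop)
  · exact fun a m n hmn H b hb => hm _ _ _ hmn (H b hb)
  · intro a
    constructor
    · intro H
      have : ∀ L : List β, (∀ b ∈ L, p a b) → ∃ n, ∀ b ∈ L, q (a, b) n := by
        intro L
        induction L with
        | nil => simp
        | cons b L ih =>
          intro hL
          obtain ⟨n, hn⟩ := ih fun b hb => hL b (List.mem_cons_of_mem _ hb)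
          obtain ⟨m, hm'⟩ := (h (a, b)).1 (hL b List.mem_cons_self)
          refine ⟨max m n, List.forall_mem_cons.2 ⟨hm _ _ _ (le_max_left _ _) hm', fun c hc => ?_⟩⟩
          exact hm _ _ _ (le_max_right _ _) (hn c hc)
      exact this _ H
    · rintro ⟨n, hn⟩ b hb
      exact (h (a, b)).2 ⟨n, hn b hb⟩

theorem exists_mem {l : α → List β} {p : α → β → Prop} (hl : Primrec l)
    (hp : Enumerable fun x : α × β => p x.1 x.2) : Enumerable fun a => ∃ b ∈ l a, p a b :=
  ex ((of_primrec (primrecPred_mem (f := fun x : α × β => x.2) (g := fun x => l x.1)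
    (by fun_prop) (by fun_prop))).and hp)

open Nat.Partrec in
theorem graph {f : α →. β} (hf : Partrec f) : Enumerable fun x : α × β => x.2 ∈ f x.1 := by
  obtain ⟨c, hc⟩ := Code.exists_code.1 hf
  refine ⟨fun x n => Code.evaln n c (Encodable.encode x.1) = some (Encodable.encode x.2), ?_, ?_, ?_⟩
  · refine primrecPred_eq ?_ (by fun_prop)
    exact Code.primrec_evaln.comp (f := fun a : (ℕ × Code) × ℕ => Code.evaln a.1.1 a.1.2 a.2)
      (g := fun x : (α × β) × ℕ => ((x.2, c), Encodable.encode x.1.1)) (by fun_prop)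
  · exact fun a m n hmn h => Code.evaln_mono hmn h
  · intro x
    refine Iff.trans ?_ Code.evaln_complete
    rw [hc]
    simp

/-- Search through the codes of pairs of a stage and a value for one whose stage confirms its value.
Other values may be related as well; only one is returned. -/
theorem exists_partrec {R : α → β → Prop} (hR : Enumerable fun x : α × β => R x.1 x.2) :
    ∃ f : α →. β, Partrec f ∧ (∀ a b, b ∈ f a → R a b) ∧ ∀ a, (∃ b, R a b) → (f a).Dom := by
  classical
  obtain ⟨q, hq, hm, h⟩ := hR
  let g : α → ℕ → Option β := fun a k => (Encodable.decode (α := ℕ × β) k).bind fun y =>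
    if q (a, y.2) y.1 then some y.2 else none
  have hg : Computable₂ g := by
    refine Primrec.to_comp ?_
    refine Primrec.option_bind (Primrec.decode.comp Primrec.snd) ?_
    refine Primrec.ite ?_ (by fun_prop) (Primrec.const _)
    exact hq.comp (f := fun x : (α × ℕ) × ℕ × β => ((x.1.1, x.2.2), x.2.1)) (by fun_prop)
  have hgm : ∀ a k b, g a k = some b → R a b := by
    intro a k b hb
    simp only [g, Option.bind_eq_some_iff] at hb
    obtain ⟨y, -, hy⟩ := hb
    split_ifs at hy with hqy
    cases hy
    exact (h (a, y.2)).2 ⟨_, hqy⟩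
  refine ⟨fun a => Nat.rfindOpt (g a), Partrec.rfindOpt hg, fun a b hb => ?_, ?_⟩
  · obtain ⟨n, hn⟩ := Nat.rfindOpt_spec hb
    exact hgm a n b hn
  · rintro a ⟨b, hb⟩
    obtain ⟨n, hn⟩ := (h (a, b)).1 hb
    refine Nat.rfindOpt_dom.2 ⟨Encodable.encode (n, b), b, ?_⟩
    simp [g, hn]

/-- A chain is stored as a list and accessed by position, so that only one unbounded quantifier over
lists is needed in place of a recursion. -/
theorem reflTransGen {γ : Type*} [Primcodable γ] {r : γ → α → α → Prop}
    (hr : Enumerable fun x : γ × α × α => r x.1 x.2.1 x.2.2) :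
    Enumerable fun x : γ × α × α => Relation.ReflTransGen (r x.1) x.2.1 x.2.2 := by
  have key : Enumerable fun x : γ × α × α => ∃ l : List α, l[0]? = some x.2.1 ∧
      (∃ n, l[n]? = some x.2.2 ∧ ∀ i ∈ List.range n, ∃ y z, l[i]? = some y ∧ l[i + 1]? = some z ∧
        r x.1 y z) := by
    refine ex (and (of_primrec (primrecPred_eq (by fun_prop) (by fun_prop))) (ex (and
      (of_primrec (primrecPred_eq (by fun_prop) (by fun_prop))) (forall_mem (by fun_prop) (ex (ex
      (and (of_primrec (primrecPred_eq (by fun_prop) (by fun_prop))) (and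
      (of_primrec (primrecPred_eq (by fun_prop) (by fun_prop))) ?_))))))))
    exact hr.comp (f := fun x : (((((γ × α × α) × List α) × ℕ) × ℕ) × α) × α =>
      (x.1.1.1.1.1.1, x.1.2, x.2)) (by fun_prop)
  refine key.of_eq fun x => ?_
  obtain ⟨c, a, b⟩ := x
  constructor
  · rintro ⟨l, h0, n, hn, hl⟩
    dsimp only at h0 hn hl ⊢
    have : ∀ i ≤ n, ∃ y, l[i]? = some y ∧ Relation.ReflTransGen (r c) a y := by
      intro i
      induction i with
      | zero => exact fun _ => ⟨a, h0, .refl⟩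
      | succ i ih =>
        intro hi
        obtain ⟨y, hy, hay⟩ := ih (by omega)
        obtain ⟨y', z, hy', hz, hyz⟩ := hl i (by simpa using hi)
        obtain rfl : y = y' := by rw [hy] at hy'; exact Option.some.inj hy'
        exact ⟨z, hz, hay.tail hyz⟩
    obtain ⟨y, hy, hay⟩ := this n le_rfl
    obtain rfl : y = b := by rw [hn] at hy; exact (Option.some.inj hy).symm
    exact hay
  · intro h
    dsimp only at h ⊢
    induction h using Relation.ReflTransGen.head_induction_on with
    | refl => exact ⟨[b], rfl, 0, rfl, by simp⟩
    | @head a d had _ ih =>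
      obtain ⟨l, h0, n, hn, hl⟩ := ih
      refine ⟨a :: l, rfl, n + 1, by simpa using hn, fun i hi => ?_⟩
      cases i with
      | zero => exact ⟨a, d, rfl, by simpa using h0, had⟩
      | succ i =>
        obtain ⟨y, z, hy, hz, hyz⟩ := hl i (by simpa using hi)
        exact ⟨y, z, by simpa using hy, by simpa using hz, hyz⟩

end Enumerable

/-! ### Ideals of the subword ordering -/

/-- The expression `[(Y₁, z₁), …, (Yₙ, zₙ)]` stands for `Y₁^* (z₁ + ε) ⋯ Yₙ^* (zₙ + ε)`. -/
abbrev IdealExpr := List (List ℕ × Option ℕ)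

/-- The word `Y₁^k z₁ ⋯ Yₙ^k zₙ`. -/
def IdealExpr.word : IdealExpr → ℕ → List ℕ
  | [], _ => []
  | x :: I, k => (List.replicate k x.1).flatten ++ (x.2.toList ++ IdealExpr.word I k)

/-- The ideal denoted by an expression. -/
def IdealExpr.lang (I : IdealExpr) : Set (List ℕ) := {w | ∃ k, w.Sublist (I.word k)}

theorem flatten_replicate_sublist {α : Type*} (Y : List α) {k l : ℕ} (h : k ≤ l) :
    (List.replicate k Y).flatten.Sublist (List.replicate l Y).flatten := by
  obtain ⟨m, rfl⟩ := Nat.exists_eq_add_of_le h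
  rw [List.replicate_add, List.flatten_append]
  exact List.sublist_append_left _ _

theorem IdealExpr.word_mono (I : IdealExpr) {k l : ℕ} (h : k ≤ l) :
    (I.word k).Sublist (I.word l) := by
  induction I with
  | nil => exact List.Sublist.refl _
  | cons x I ih =>
    exact (flatten_replicate_sublist _ h).append ((List.Sublist.refl _).append ih)

theorem IdealExpr.lang_of_sublist {I : IdealExpr} {u v : List ℕ} (huv : u.Sublist v)
    (hv : v ∈ I.lang) : u ∈ I.lang :=
  let ⟨k, hk⟩ := hv
  ⟨k, huv.trans hk⟩

theorem IdealExpr.nil_mem_lang (I : IdealExpr) : [] ∈ I.lang := ⟨0, List.nil_sublist _⟩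

theorem IdealExpr.word_mem_lang (I : IdealExpr) (k : ℕ) : I.word k ∈ I.lang :=
  ⟨k, List.Sublist.refl _⟩

/-- The words `I.word k` are cofinal in the ideal. -/
theorem IdealExpr.lang_subset_iff {I : IdealExpr} {D : Set (List ℕ)}
    (hD : ∀ u v : List ℕ, u.Sublist v → v ∈ D → u ∈ D) : I.lang ⊆ D ↔ ∀ k, I.word k ∈ D :=
  ⟨fun h k => h (I.word_mem_lang k), fun h _ ⟨k, hk⟩ => hD _ _ hk (h k)⟩

theorem IdealExpr.mem_lang_cons {x : List ℕ × Option ℕ} {I : IdealExpr} {w : List ℕ}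
    (hw : w ∈ I.lang) : w ∈ IdealExpr.lang (x :: I) := by
  obtain ⟨k, hk⟩ := hw
  exact ⟨k, (hk.trans (List.sublist_append_right _ _)).trans (List.sublist_append_right _ _)⟩

theorem IdealExpr.mem_lang_append {P I : IdealExpr} {w : List ℕ}
    (hw : w ∈ I.lang) : w ∈ IdealExpr.lang (P ++ I) := by
  induction P with
  | nil => exact hw
  | cons x P ih => exact mem_lang_cons ih

theorem IdealExpr.cons_mem_lang_of_mem {a : ℕ} {x : List ℕ × Option ℕ} {I : IdealExpr}
    {w : List ℕ} (ha : a ∈ x.1) (hw : w ∈ IdealExpr.lang (x :: I)) :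
    a :: w ∈ IdealExpr.lang (x :: I) := by
  obtain ⟨k, hk⟩ := hw
  refine ⟨k + 1, ?_⟩
  rw [IdealExpr.word, List.replicate_succ, List.flatten_cons, List.append_assoc]
  refine (List.singleton_sublist.2 ha).append (hk.trans ?_)
  exact (List.Sublist.refl _).append ((List.Sublist.refl _).append (I.word_mono k.le_succ))

theorem IdealExpr.cons_mem_lang_of_eq_some {a : ℕ} {x : List ℕ × Option ℕ} {I : IdealExpr}
    {w : List ℕ} (ha : x.2 = some a) (hw : w ∈ I.lang) :
    a :: w ∈ IdealExpr.lang (x :: I) := by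
  obtain ⟨k, hk⟩ := hw
  refine ⟨k, ?_⟩
  rw [IdealExpr.word, ha]
  exact (hk.cons_cons a).trans (List.sublist_append_right _ _)

/-- One way in which the ideal `I` may read the letter `a`, after which the ideal `I'` remains. -/
def IdealExpr.Step (I : IdealExpr) (a : ℕ) (I' : IdealExpr) : Prop :=
  ∃ (P : IdealExpr) (x : List ℕ × Option ℕ) (J : IdealExpr), I = P ++ x :: J ∧
    ((a ∈ x.1 ∧ I' = x :: J) ∨ (x.2 = some a ∧ I' = J))

theorem IdealExpr.Step.cons_mem {I I' : IdealExpr} {a : ℕ} {w : List ℕ} (h : I.Step a I')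
    (hw : w ∈ I'.lang) : a :: w ∈ I.lang := by
  obtain ⟨P, x, J, rfl, ⟨ha, rfl⟩ | ⟨ha, rfl⟩⟩ := h
  · exact mem_lang_append (cons_mem_lang_of_mem ha hw)
  · exact mem_lang_append (cons_mem_lang_of_eq_some ha hw)

/-- This keeps the set of expressions reachable from a given one finite. -/
theorem IdealExpr.Step.suffix {I I' : IdealExpr} {a : ℕ} (h : I.Step a I') : I' <:+ I := by
  obtain ⟨P, x, J, rfl, ⟨ha, rfl⟩ | ⟨ha, rfl⟩⟩ := h
  · exact ⟨P, rfl⟩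
  · exact ⟨P ++ [x], by simp⟩

theorem IdealExpr.Step.cons {I I' : IdealExpr} {a : ℕ} (h : I.Step a I')
    (x : List ℕ × Option ℕ) : IdealExpr.Step (x :: I) a I' := by
  obtain ⟨P, y, J, rfl, h⟩ := h
  exact ⟨x :: P, y, J, rfl, h⟩

theorem sublist_of_cons_sublist_append {α : Type*} {a : α} {w u v : List α} (ha : a ∉ u)
    (h : (a :: w).Sublist (u ++ v)) : (a :: w).Sublist v := by
  induction u with
  | nil => exact h
  | cons b u ih =>
    rw [List.mem_cons, not_or] at ha
    cases h with
    | cons _ h => exact ih ha.2 h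
    | cons_cons _ h => exact absurd rfl ha.1

/-- The letter is read greedily: the positions before the first one that can produce `a` cannot
contribute to a word starting with `a`, so nothing is lost by dropping them. -/
theorem IdealExpr.exists_step {I : IdealExpr} {a : ℕ} {w : List ℕ} (h : a :: w ∈ I.lang) :
    ∃ I', I.Step a I' ∧ w ∈ IdealExpr.lang I' := by
  induction I with
  | nil =>
    obtain ⟨k, hk⟩ := h
    cases hk
  | cons x I ih =>
    by_cases ha : a ∈ x.1
    · exact ⟨x :: I, ⟨[], x, I, rfl, .inl ⟨ha, rfl⟩⟩, lang_of_sublist (List.sublist_cons_self _ _) h⟩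
    · obtain ⟨k, hk⟩ := h
      have hk' := sublist_of_cons_sublist_append (by simp [ha]) hk
      by_cases hx : x.2 = some a
      · rw [hx] at hk'
        exact ⟨I, ⟨[], x, I, rfl, .inr ⟨hx, rfl⟩⟩, k, List.cons_sublist_cons.1 hk'⟩
      · obtain ⟨I', hI, hw⟩ := ih ⟨k, sublist_of_cons_sublist_append (by simpa using hx) hk'⟩
        exact ⟨I', hI.cons x, hw⟩

/-- The ideal of all subwords of `v`. -/
def IdealExpr.ofWord (v : List ℕ) : IdealExpr := v.map fun b => ([], some b)

theorem IdealExpr.word_ofWord (v : List ℕ) (k : ℕ) : (ofWord v).word k = v := by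
  induction v with
  | nil => rfl
  | cons b v ih =>
    have : (List.replicate k ([] : List ℕ)).flatten = [] := by simp
    simpa [ofWord, word, this] using ih

/-! ### Downward closed languages over a finite alphabet -/

/-- `D` consists of words over `X` and is closed under subwords. -/
structure IsDownwardClosedOver (X : List ℕ) (D : Set (List ℕ)) : Prop where
  mem_alphabet : ∀ w ∈ D, ∀ a ∈ w, a ∈ X
  down : ∀ u v : List ℕ, u.Sublist v → v ∈ D → u ∈ D

/-- Higman's lemma. -/
theorem exists_lt_sublist (X : List ℕ) (f : ℕ → List ℕ) (hf : ∀ n, ∀ a ∈ f n, a ∈ X) :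
    ∃ m n, m < n ∧ (f m).Sublist (f n) := by
  have hX : {a : ℕ | a ∈ X}.PartiallyWellOrderedOn Eq := by
    have : {a : ℕ | a ∈ X}.Finite := List.finite_toSet X
    exact this.partiallyWellOrderedOn
  have := Set.PartiallyWellOrderedOn.partiallyWellOrderedOn_sublistForall₂ (· = ·) hX
  obtain ⟨m, n, hmn, h⟩ := this fun n => ⟨f n, hf n⟩
  refine ⟨m, n, hmn, ?_⟩
  obtain ⟨l, hl, hs⟩ := List.sublistForall₂_iff.1 h
  rw [List.forall₂_eq_eq_eq] at hl
  obtain rfl : f m = l := hl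
  exact hs

/-- In a strictly descending chain, choose `f n` in the n-th set but not in the next. Higman's lemma
gives m < n with `f m` a subword of `f n`, which lies in the (m+1)-st set; hence so does `f m`, a
contradiction. -/
theorem IsDownwardClosedOver.induction {X : List ℕ} {P : Set (List ℕ) → Prop}
    (step : ∀ D, IsDownwardClosedOver X D →
      (∀ D', IsDownwardClosedOver X D' → D' ⊂ D → P D') → P D) {D : Set (List ℕ)}
    (hD : IsDownwardClosedOver X D) : P D := by
  have wf : WellFounded fun D D' : {D // IsDownwardClosedOver X D} => D.1 ⊂ D'.1 := by
    rw [wellFounded_iff_isEmpty_descending_chain]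
    refine ⟨fun ⟨s, hs⟩ => ?_⟩
    have hanti : ∀ m n, m ≤ n → (s n).1 ⊆ (s m).1 := fun m n hmn => by
      induction n, hmn using Nat.le_induction with
      | base => exact subset_rfl
      | succ n _ ih => exact (hs n).subset.trans ih
    choose f hf hf' using fun n => Set.exists_of_ssubset (hs n)
    obtain ⟨m, n, hmn, h⟩ := exists_lt_sublist X f fun n => (s n).2.mem_alphabet _ (hf n)
    exact hf' m (hanti (m + 1) n hmn ((s n).2.down _ _ h (hf n)))
  exact wf.induction (C := fun D => P D.1) ⟨D, hD⟩ fun D ih =>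
    step D.1 D.2 fun D' hD' h => ih ⟨D', hD'⟩ h

/-- Every residual R a = a⁻¹D is included in D. Let Y consist of the letters with R a = D; these can
be prepended freely. At the first other letter a of a word, the rest lies in the smaller set R a, to
which induction applies. So for nonempty D one gets D = Y^* ∪ ⋃ Y^* (a + ε) I, over the letters a of
X outside Y and the ideals I of R a. -/
theorem IsDownwardClosedOver.exists_ideals {X : List ℕ} {D : Set (List ℕ)}
    (hD : IsDownwardClosedOver X D) :
    ∃ Is : List IdealExpr, ∀ w, w ∈ D ↔ ∃ I ∈ Is, w ∈ IdealExpr.lang I := by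
  classical
  refine IsDownwardClosedOver.induction (P := fun D => ∃ Is : List IdealExpr,
    ∀ w, w ∈ D ↔ ∃ I ∈ Is, w ∈ IdealExpr.lang I) (fun D hD ih => ?_) hD
  rcases D.eq_empty_or_nonempty with rfl | ⟨w₀, hw₀⟩
  · exact ⟨[], by simp⟩
  have hnil : [] ∈ D := hD.down _ _ (List.nil_sublist _) hw₀
  let R : ℕ → Set (List ℕ) := fun a => {w | a :: w ∈ D}
  have hR : ∀ a, IsDownwardClosedOver X (R a) := fun a =>
    ⟨fun w hw b hb => hD.mem_alphabet _ hw b (List.mem_cons_of_mem _ hb),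
      fun u v huv hv => hD.down _ _ (huv.cons_cons a) hv⟩
  have hRD : ∀ a, R a ⊆ D := fun a w hw => hD.down _ _ (List.sublist_cons_self _ _) hw
  let Y := X.filter fun a => R a = D
  have hY : ∀ a, a ∈ Y ↔ a ∈ X ∧ R a = D := fun a => by simp [Y]
  have hYD : ∀ k w, w ∈ D → (List.replicate k Y).flatten ++ w ∈ D := by
    have h1 : ∀ u w : List ℕ, (∀ a ∈ u, a ∈ Y) → w ∈ D → u ++ w ∈ D := by
      intro u w hu hw
      induction u with
      | nil => exact hw
      | cons a u ih =>
        have := ih fun b hb => hu b (List.mem_cons_of_mem _ hb)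
        rw [← ((hY a).1 (hu a List.mem_cons_self)).2] at this
        exact this
    refine fun k w hw => h1 _ w (fun a ha => ?_) hw
    obtain ⟨l, hl, ha⟩ := List.mem_flatten.1 ha
    rwa [← List.eq_of_mem_replicate hl]
  have hK : ∀ a, ∃ Is : List IdealExpr, R a ≠ D →
      ∀ w, w ∈ R a ↔ ∃ I ∈ Is, w ∈ IdealExpr.lang I := fun a => by
    by_cases h : R a = D
    -- A dummy value: letters with R a = D are filtered out below.
    · exact ⟨[], fun h' => absurd h h'⟩
    · obtain ⟨Is, hIs⟩ := ih (R a) (hR a) ((hRD a).ssubset_of_ne h)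
      exact ⟨Is, fun _ => hIs⟩
  choose K hK using hK
  refine ⟨[(Y, none)] :: (X.filter fun a => R a ≠ D).flatMap fun a =>
    (K a).map fun I => (Y, some a) :: I, fun w => ⟨fun hw => ?_, ?_⟩⟩
  · induction w with
    | nil => exact ⟨_, List.mem_cons_self, IdealExpr.nil_mem_lang _⟩
    | cons a w ihw =>
      by_cases ha : R a = D
      · have haY : a ∈ Y := (hY a).2 ⟨hD.mem_alphabet _ hw a List.mem_cons_self, ha⟩
        obtain ⟨I, hI, hwI⟩ := ihw (ha ▸ hw)
        refine ⟨I, hI, ?_⟩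
        rcases List.mem_cons.1 hI with rfl | hI
        · exact IdealExpr.cons_mem_lang_of_mem haY hwI
        · obtain ⟨b, -, hb⟩ := List.mem_flatMap.1 hI
          obtain ⟨I', -, rfl⟩ := List.mem_map.1 hb
          exact IdealExpr.cons_mem_lang_of_mem haY hwI
      · obtain ⟨I, hI, hwI⟩ := (hK a ha w).1 hw
        refine ⟨(Y, some a) :: I, List.mem_cons_of_mem _ (List.mem_flatMap.2 ⟨a, ?_, ?_⟩),
          IdealExpr.cons_mem_lang_of_eq_some rfl hwI⟩
        · simpa using ⟨hD.mem_alphabet _ hw a List.mem_cons_self, ha⟩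
        · exact List.mem_map_of_mem hI
  · rintro ⟨I, hI, hw⟩
    refine (IdealExpr.lang_subset_iff hD.down).2 (fun k => ?_) hw
    rcases List.mem_cons.1 hI with rfl | hI
    · exact hYD k _ hnil
    · obtain ⟨b, hb, hI⟩ := List.mem_flatMap.1 hI
      obtain ⟨I', hI', rfl⟩ := List.mem_map.1 hI
      refine hYD k _ ?_
      exact (hK b (by simpa using (List.mem_filter.1 hb).2) _).2 ⟨I', hI', IdealExpr.word_mem_lang I' k⟩

/-- The minimal words over X outside D are pairwise incomparable, hence finitely many by Higman's
lemma; descent on length finds one below any word outside D. -/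
theorem exists_forbidden (X : List ℕ) (D : Set (List ℕ)) :
    ∃ F : List (List ℕ), (∀ f ∈ F, f ∉ D) ∧
      ∀ w : List ℕ, (∀ a ∈ w, a ∈ X) → w ∉ D → ∃ f ∈ F, f.Sublist w := by
  let M : Set (List ℕ) :=
    {f | (∀ a ∈ f, a ∈ X) ∧ f ∉ D ∧ ∀ g : List ℕ, g.Sublist f → g ∉ D → g = f}
  have hM : M.Finite := by
    by_contra hinf
    let e := Set.Infinite.natEmbedding M hinf
    obtain ⟨m, n, hmn, h⟩ := exists_lt_sublist X (fun n => (e n).1) fun n => (e n).2.1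
    have := e.injective (Subtype.ext ((e n).2.2.2 _ h (e m).2.2.1))
    omega
  refine ⟨hM.toFinset.toList, fun f hf => ?_, fun w => ?_⟩
  · have : f ∈ M := by simpa using hf
    exact this.2.1
  · induction hn : w.length using Nat.strong_induction_on generalizing w with
    | _ n ih =>
    intro hw hwD
    by_cases hmin : w ∈ M
    · exact ⟨w, by simpa using hmin, List.Sublist.refl _⟩
    · have : ∃ g : List ℕ, g.Sublist w ∧ g ∉ D ∧ g ≠ w := by
        by_contra! h
        exact hmin ⟨hw, hwD, h⟩
      obtain ⟨g, hg, hgD, hne⟩ := this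
      have hlt : g.length < n := hn ▸ lt_of_le_of_ne hg.length_le fun h => hne (hg.eq_of_length h)
      obtain ⟨f, hf, hfg⟩ := ih _ hlt g rfl (fun a ha => hw a (hg.subset ha)) hgD
      exact ⟨f, hf, hfg.trans hg⟩


/-! ### Bounded languages -/

/-- The word `a₁^k ⋯ aₙ^k`. -/
def blockWord : List ℕ → ℕ → List ℕ
  | [], _ => []
  | a :: as, k => List.replicate k a ++ blockWord as k

theorem blockWord_mono (as : List ℕ) {k l : ℕ} (h : k ≤ l) :
    (blockWord as k).Sublist (blockWord as l) := by
  induction as with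
  | nil => exact List.Sublist.refl _
  | cons a as ih => exact (List.replicate_sublist_replicate a |>.2 h).append ih

theorem mem_boundedStar_nil {w : List ℕ} : w ∈ boundedStar [] ↔ w = [] := by
  simp [boundedStar]

theorem mem_boundedStar_cons {a : ℕ} {as w : List ℕ} :
    w ∈ boundedStar (a :: as) ↔ ∃ k, ∃ w' ∈ boundedStar as, w = List.replicate k a ++ w' := by
  rw [boundedStar, List.map_cons, List.prod_cons, Language.mem_mul]
  constructor
  · rintro ⟨u, hu, v, hv, rfl⟩
    obtain ⟨S, rfl, hS⟩ := Language.mem_kstar.1 hu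
    refine ⟨S.length, v, hv, ?_⟩
    congr 1
    have : S = List.replicate S.length [a] := List.eq_replicate_iff.2 ⟨rfl, fun y hy => hS y hy⟩
    rw [this]
    simp
  · rintro ⟨k, v, hv, rfl⟩
    refine ⟨List.replicate k a, Language.mem_kstar.2 ⟨List.replicate k [a], by simp, ?_⟩, v, hv, rfl⟩
    exact fun y hy => List.eq_of_mem_replicate hy

theorem blockWord_mem_boundedStar (as : List ℕ) (k : ℕ) : blockWord as k ∈ boundedStar as := by
  induction as with
  | nil => exact mem_boundedStar_nil.2 rfl
  | cons a as ih => exact mem_boundedStar_cons.2 ⟨k, _, ih, rfl⟩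

theorem sublist_blockWord {as w : List ℕ} {k : ℕ} (hw : w ∈ boundedStar as) (hk : w.length ≤ k) :
    w.Sublist (blockWord as k) := by
  induction as generalizing w with
  | nil => rw [mem_boundedStar_nil.1 hw]; exact List.nil_sublist _
  | cons a as ih =>
    obtain ⟨l, v, hv, rfl⟩ := mem_boundedStar_cons.1 hw
    rw [List.length_append, List.length_replicate] at hk
    exact (List.replicate_sublist_replicate a |>.2 (by omega)).append (ih hv (by omega))

theorem mem_boundedStar_of_sublist {as v w : List ℕ} (h : v.Sublist w) (hw : w ∈ boundedStar as) :
    v ∈ boundedStar as := by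
  induction as generalizing v w with
  | nil =>
    rw [mem_boundedStar_nil] at hw ⊢
    exact List.sublist_nil.1 (hw ▸ h)
  | cons a as ih =>
    obtain ⟨l, w', hw', rfl⟩ := mem_boundedStar_cons.1 hw
    obtain ⟨v₁, v₂, rfl, h₁, h₂⟩ := List.sublist_append_iff.1 h
    obtain ⟨j, -, rfl⟩ := List.sublist_replicate_iff.1 h₁
    exact mem_boundedStar_cons.2 ⟨j, v₂, ih h₂ hw', rfl⟩

theorem downwardClosure_down (L : Language ℕ) (u v : List ℕ) (h : u.Sublist v)
    (hv : v ∈ downwardClosure L) : u ∈ downwardClosure L :=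
  let ⟨w, hw, hvw⟩ := hv
  ⟨w, hw, h.trans hvw⟩

/-- Every word of a₁^* ⋯ aₙ^* is a subword of some a₁^k ⋯ aₙ^k, so these blocks decide equality once
the other inclusion is promised. -/
theorem downwardClosure_eq_boundedStar_iff {L : Language ℕ} {as : List ℕ}
    (h : L ≤ boundedStar as) :
    downwardClosure L = boundedStar as ↔ ∀ k, blockWord as k ∈ downwardClosure L := by
  constructor
  · intro h k
    rw [h]
    exact blockWord_mem_boundedStar as k
  · intro hk
    refine Set.Subset.antisymm ?_ fun w hw => ?_
    · rintro u ⟨v, hv, huv⟩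
      exact mem_boundedStar_of_sublist huv (h hv)
    · exact downwardClosure_down L _ _ (sublist_blockWord hw le_rfl) (hk _)

/-! ### Transducers for downward closures and for ideals -/

/-- The transducer that deletes letters from words over `X`. -/
def deletion (X : List ℕ) : Transducer :=
  (X.map (fun x => (0, [x], [], 0)) ++ X.map (fun x => (0, [x], [x], 0)), 0, [0])

/-- This uses the alphabet given with a representation: there must be an edge for each letter that
can occur. -/
theorem image_deletion {X : List ℕ} {L : Language ℕ} (hL : ∀ w ∈ L, ∀ a ∈ w, a ∈ X) :
    image (deletion X).transduction L = downwardClosure L := by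
  have h₁ : ∀ p u v q, TransPath (deletion X).1 p u v q → v.Sublist u := by
    intro p u v q h
    induction h with
    | nil => exact List.Sublist.refl _
    | cons he _ ih =>
      refine List.Sublist.append ?_ ih
      simp only [deletion, List.mem_append, List.mem_map] at he
      rcases he with ⟨x, -, hx⟩ | ⟨x, -, hx⟩ <;> cases hx <;> simp
  have h₂ : ∀ u v : List ℕ, v.Sublist u → (∀ a ∈ u, a ∈ X) →
      TransPath (deletion X).1 0 u v 0 := by
    intro u v h
    induction h with
    | slnil => exact fun _ => .nil 0
    | @cons v u a _ ih =>
      intro hu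
      rw [List.forall_mem_cons] at hu
      exact .cons (u := [a]) (v := []) (q := 0) (by simp [deletion, hu.1]) (ih hu.2)
    | @cons_cons v u a _ ih =>
      intro hu
      rw [List.forall_mem_cons] at hu
      exact .cons (u := [a]) (v := [a]) (q := 0) (by simp [deletion, hu.1]) (ih hu.2)
  refine Set.Subset.antisymm ?_ ?_
  · rintro v ⟨u, hu, f, hf, h⟩
    exact ⟨u, hu, h₁ _ _ _ _ h⟩
  · rintro v ⟨u, hu, h⟩
    exact ⟨u, hu, 0, by simp [deletion], h₂ u v h (hL u hu)⟩

/-- The symbol (and the state) that belongs to a position is the number of remaining positions. -/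
def IdealExpr.symbols : IdealExpr → List ℕ
  | [] => []
  | _ :: I => (I.length + 1) :: IdealExpr.symbols I

/-- The leaving edge must read zᵢ if there is one. This loses nothing, since the transducer will be
applied to a downward closed language. -/
def IdealExpr.edges : IdealExpr → List (ℕ × List ℕ × List ℕ × ℕ)
  | [] => []
  | x :: I => (I.length + 1, x.1, [I.length + 1], I.length + 1) ::
      (I.length + 1, x.2.toList, [], I.length) :: IdealExpr.edges I

/-- The transducer that counts the repetitions of each `Yᵢ` in `Y₁^{k₁} z₁ ⋯ Yₙ^{kₙ} zₙ`. -/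
def IdealExpr.transducer (I : IdealExpr) : Transducer := (I.edges, I.length, [0])

theorem IdealExpr.le_of_mem_symbols {I : IdealExpr} {a : ℕ} (h : a ∈ I.symbols) :
    a ≤ I.length := by
  induction I with
  | nil => simp [symbols] at h
  | cons x I ih =>
    rcases List.mem_cons.1 h with rfl | h
    · simp
    · exact (ih h).trans (by simp)

theorem IdealExpr.symbols_nodup (I : IdealExpr) : I.symbols.Nodup := by
  induction I with
  | nil => exact List.nodup_nil
  | cons x I ih => exact List.nodup_cons.2 ⟨fun h => by have := le_of_mem_symbols h; omega, ih⟩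

theorem IdealExpr.mem_edges_iff {I : IdealExpr} {e : ℕ × List ℕ × List ℕ × ℕ} :
    e ∈ I.edges ↔ ∃ (P : IdealExpr) (x : List ℕ × Option ℕ) (J : IdealExpr), I = P ++ x :: J ∧
      (e = (J.length + 1, x.1, [J.length + 1], J.length + 1) ∨
        e = (J.length + 1, x.2.toList, [], J.length)) := by
  induction I with
  | nil => simp [edges]
  | cons y I ih =>
    rw [edges, List.mem_cons, List.mem_cons, ih]
    constructor
    · rintro (h | h | ⟨P, x, J, rfl, h⟩)
      · exact ⟨[], y, I, rfl, .inl h⟩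
      · exact ⟨[], y, I, rfl, .inr h⟩
      · exact ⟨y :: P, x, J, rfl, h⟩
    · rintro ⟨P, x, J, hI, h⟩
      cases P with
      | nil =>
        rw [List.nil_append, List.cons.injEq] at hI
        obtain ⟨rfl, rfl⟩ := hI
        exact h.imp_right .inl
      | cons z P =>
        rw [List.cons_append, List.cons.injEq] at hI
        exact .inr (.inr ⟨P, x, J, hI.2, h⟩)

/-- The transduction of `IdealExpr.transducer`. -/
def IdealExpr.Counts : IdealExpr → List ℕ → List ℕ → Prop
  | [], u, v => u = [] ∧ v = []
  | x :: I, u, v => ∃ k u' v', IdealExpr.Counts I u' v' ∧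
      u = (List.replicate k x.1).flatten ++ (x.2.toList ++ u') ∧
      v = List.replicate k (I.length + 1) ++ v'

/-- The current state is the length of the suffix `J` still to be processed, so it determines that
suffix and with it the available edges. -/
theorem IdealExpr.counts_of_transPath {I : IdealExpr} {p q : ℕ} {u v : List ℕ}
    (h : TransPath I.edges p u v q) (hq : q = 0) {P J : IdealExpr} (hI : I = P ++ J)
    (hp : p = J.length) : Counts J u v := by
  induction h generalizing P J with
  | nil p =>
    obtain rfl : J = [] := List.eq_nil_of_length_eq_zero (hp.symm.trans hq)
    exact ⟨rfl, rfl⟩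
  | cons he _ ih =>
    obtain ⟨P', x, J', hI', he⟩ := mem_edges_iff.1 he
    have hlen : J.length = (x :: J').length := by
      rw [← hp]
      rcases he with he | he <;> exact congrArg Prod.fst he
    obtain ⟨-, rfl⟩ := List.append_inj' (hI.symm.trans hI') hlen
    rcases he with he | he
    · obtain ⟨-, rfl, rfl, rfl⟩ := by simpa using he
      obtain ⟨k, u', v', hc, rfl, rfl⟩ := ih hq hI rfl
      exact ⟨k + 1, u', v', hc, by simp [List.replicate_succ], by simp [List.replicate_succ]⟩
    · obtain ⟨-, rfl, rfl, rfl⟩ := by simpa using he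
      have := ih hq (P := P ++ [x]) (J := J') (by simpa using hI) rfl
      exact ⟨0, _, _, this, by simp, by simp⟩

theorem IdealExpr.transPath_of_counts {I P J : IdealExpr} {u v : List ℕ} (hI : I = P ++ J)
    (h : Counts J u v) : TransPath I.edges J.length u v 0 := by
  induction J generalizing P u v with
  | nil =>
    obtain ⟨rfl, rfl⟩ := h
    exact .nil 0
  | cons x J ih =>
    obtain ⟨k, u', v', h, rfl, rfl⟩ := h
    have h₀ := ih (P := P ++ [x]) (by simpa using hI) h
    induction k with
    | zero =>
      have := TransPath.cons (mem_edges_iff.2 ⟨P, x, J, hI, .inr rfl⟩) h₀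
      simpa using this
    | succ k ihk =>
      have := TransPath.cons (mem_edges_iff.2 ⟨P, x, J, hI, .inl rfl⟩) ihk
      simpa [List.replicate_succ] using this

theorem IdealExpr.mem_transduction_iff {I : IdealExpr} {u v : List ℕ} :
    (u, v) ∈ I.transducer.transduction ↔ Counts I u v := by
  constructor
  · rintro ⟨f, hf, h⟩
    exact counts_of_transPath h (List.mem_singleton.1 hf) (P := []) rfl rfl
  · exact fun h => ⟨0, List.mem_singleton.2 rfl, transPath_of_counts (P := []) rfl h⟩

theorem IdealExpr.Counts.mem_boundedStar {I : IdealExpr} {u v : List ℕ} (h : Counts I u v) :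
    v ∈ boundedStar I.symbols := by
  induction I generalizing u v with
  | nil => exact mem_boundedStar_nil.2 h.2
  | cons x I ih =>
    obtain ⟨k, u', v', h, -, rfl⟩ := h
    exact mem_boundedStar_cons.2 ⟨k, v', ih h, rfl⟩

theorem IdealExpr.counts_word (I : IdealExpr) (k : ℕ) :
    Counts I (I.word k) (blockWord I.symbols k) := by
  induction I with
  | nil => exact ⟨rfl, rfl⟩
  | cons x I ih => exact ⟨k, _, _, ih, rfl, rfl⟩

theorem mem_of_mem_boundedStar {as w : List ℕ} (h : w ∈ boundedStar as) {a : ℕ} (ha : a ∈ w) :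
    a ∈ as := by
  induction as generalizing w with
  | nil => rw [mem_boundedStar_nil.1 h] at ha; cases ha
  | cons b as ih =>
    obtain ⟨k, v, hv, rfl⟩ := mem_boundedStar_cons.1 h
    rcases List.mem_append.1 ha with ha | ha
    · exact List.mem_cons.2 (.inl (List.eq_of_mem_replicate ha))
    · exact List.mem_cons_of_mem _ (ih hv ha)

/-- The first symbol exceeds all later ones and so occurs only in the first block. Counting it
compares the first exponents; filtering it out leaves the statement for the remaining blocks. -/
theorem IdealExpr.Counts.word_sublist {I : IdealExpr} {u v : List ℕ} {k : ℕ} (h : Counts I u v)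
    (hv : (blockWord I.symbols k).Sublist v) : (I.word k).Sublist u := by
  induction I generalizing u v with
  | nil => exact List.nil_sublist _
  | cons x I ih =>
    obtain ⟨l, u', v', h, rfl, rfl⟩ := h
    have hnot : ∀ w ∈ boundedStar (IdealExpr.symbols I), I.length + 1 ∉ w := fun w hw hm => by
      have := le_of_mem_symbols (mem_of_mem_boundedStar hw hm)
      omega
    have h₁ := hnot _ (blockWord_mem_boundedStar _ k)
    have h₂ := hnot _ h.mem_boundedStar
    have hfilter : ∀ (m : ℕ) (w : List ℕ), I.length + 1 ∉ w →
        (List.replicate m (I.length + 1) ++ w).filter (fun a => a ≠ I.length + 1) = w := by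
      intro m w hw
      rw [List.filter_append, List.filter_replicate_of_neg (by simp), List.nil_append,
        List.filter_eq_self]
      intro a ha
      have hne : a ≠ I.length + 1 := fun e => hw (e ▸ ha)
      simpa using hne
    have hk : k ≤ l := by
      have := hv.count_le (I.length + 1)
      simpa [symbols, blockWord, List.count_append, List.count_eq_zero_of_not_mem, h₁, h₂] using this
    have hs := hv.filter fun a => a ≠ I.length + 1
    rw [symbols, blockWord, hfilter _ _ h₁, hfilter _ _ h₂] at hs
    exact (flatten_replicate_sublist _ hk).append ((List.Sublist.refl _).append (ih h hs))

theorem IdealExpr.image_le (I : IdealExpr) (L : Language ℕ) :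
    image I.transducer.transduction L ≤ boundedStar I.symbols := by
  rintro v ⟨u, -, h⟩
  exact (mem_transduction_iff.1 h).mem_boundedStar

/-- An output above the k-th block comes from a word of D in which each Yᵢ is repeated at least k
times, and this has `I.word k` as a subword. Conversely, `I.word k` itself is mapped to the k-th
block. -/
theorem IdealExpr.lang_subset_iff_image (I : IdealExpr) (L : Language ℕ) :
    downwardClosure (image I.transducer.transduction (downwardClosure L)) = boundedStar I.symbols ↔
      I.lang ⊆ downwardClosure L := by
  rw [downwardClosure_eq_boundedStar_iff (I.image_le _), lang_subset_iff (downwardClosure_down L)]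
  refine forall_congr' fun k => ⟨?_, fun h => ?_⟩
  · rintro ⟨v, ⟨u, hu, h⟩, hv⟩
    exact downwardClosure_down L _ _ ((mem_transduction_iff.1 h).word_sublist hv) hu
  · exact ⟨_, ⟨_, h, mem_transduction_iff.2 (I.counts_word k)⟩, List.Sublist.refl _⟩

/-! ### Deciding inclusions of ideals -/

/-- `f`, as a procedure for closure under transductions, and `g`, as a procedure for the
simultaneous unboundedness problem, yield the answer `b` to whether the downward closure of the
language represented by `r` includes the ideal `I`. -/
def IdealAnswer (f : Transducer × (List ℕ × ℕ) →. List ℕ × ℕ)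
    (g : List ℕ × (List ℕ × ℕ) →. Bool) (r : List ℕ × ℕ) (I : IdealExpr) (b : Bool) : Prop :=
  ∃ r₁ r₂, r₁ ∈ f (deletion r.1, r) ∧ r₂ ∈ f (I.transducer, r₁) ∧ b ∈ g (I.symbols, r₂)

/-- Partial functions are single-valued, so the intermediate representations are forced and exactly
one answer can be enumerated. The SUP promise holds by construction. -/
theorem idealAnswer_spec {C : LanguageClass} {f : Transducer × (List ℕ × ℕ) →. List ℕ × ℕ}
    {g : List ℕ × (List ℕ × ℕ) →. Bool}
    (hf : ∀ (A : Transducer), ∀ r ∈ C.rep,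
      ∃ r' ∈ f (A, r), r' ∈ C.rep ∧ C.lang r' = image A.transduction (C.lang r))
    (hg : ∀ (as : List ℕ), ∀ r ∈ C.rep, as.Nodup → C.lang r ≤ boundedStar as →
      ∃ b ∈ g (as, r), (b = true ↔ downwardClosure (C.lang r) = boundedStar as))
    {r : List ℕ × ℕ} (hr : r ∈ C.rep) (I : IdealExpr) :
    ∃ b, (b = true ↔ I.lang ⊆ downwardClosure (C.lang r)) ∧
      ∀ b', IdealAnswer f g r I b' ↔ b' = b := by
  obtain ⟨r₁, h₁, hr₁, e₁⟩ := hf (deletion r.1) r hr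
  obtain ⟨r₂, h₂, hr₂, e₂⟩ := hf I.transducer r₁ hr₁
  rw [e₁, image_deletion (C.lang_over r hr)] at e₂
  obtain ⟨b, hb, e₃⟩ := hg I.symbols r₂ hr₂ I.symbols_nodup (e₂ ▸ I.image_le _)
  rw [e₂] at e₃
  refine ⟨b, e₃.trans (I.lang_subset_iff_image _), fun b' => ⟨?_, ?_⟩⟩
  · rintro ⟨r₁', r₂', h₁', h₂', hb'⟩
    obtain rfl := Part.mem_unique h₁ h₁'
    obtain rfl := Part.mem_unique h₂ h₂'
    exact Part.mem_unique hb' hb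
  · rintro rfl
    exact ⟨r₁, r₂, h₁, h₂, hb⟩

@[fun_prop] theorem primrec_deletion {α : Type*} [Primcodable α] {f : α → List ℕ}
    (hf : Primrec f) : Primrec fun a => deletion (f a) := by
  unfold deletion
  fun_prop

@[fun_prop] theorem primrec_symbols {α : Type*} [Primcodable α] {f : α → IdealExpr}
    (hf : Primrec f) : Primrec fun a => (f a).symbols := by
  have : Primrec IdealExpr.symbols := by
    refine (Primrec.list_rec (f := fun I : IdealExpr => I) (g := fun _ => ([] : List ℕ))
      (h := fun _ x => (x.2.1.length + 1) :: x.2.2) (by fun_prop) (by fun_prop) ?_).of_eq ?_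
    · refine Primrec₂.mk ?_
      fun_prop
    · intro I
      induction I with
      | nil => rfl
      | cons x I ih => exact congrArg _ ih
  exact this.comp hf

@[fun_prop] theorem primrec_transducer {α : Type*} [Primcodable α] {f : α → IdealExpr}
    (hf : Primrec f) : Primrec fun a => (f a).transducer := by
  have : Primrec IdealExpr.edges := by
    refine (Primrec.list_rec (f := fun I : IdealExpr => I)
      (g := fun _ => ([] : List (ℕ × List ℕ × List ℕ × ℕ)))
      (h := fun _ x => (x.2.1.length + 1, x.1.1, [x.2.1.length + 1], x.2.1.length + 1) ::
        (x.2.1.length + 1, x.1.2.toList, [], x.2.1.length) :: x.2.2)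
        (by fun_prop) (by fun_prop) ?_).of_eq ?_
    · refine Primrec₂.mk ?_
      fun_prop
    · intro I
      induction I with
      | nil => rfl
      | cons x I ih => exact congrArg (fun l => _ :: _ :: l) ih
  have h := this.comp hf
  unfold IdealExpr.transducer
  fun_prop

theorem enumerable_idealAnswer {f : Transducer × (List ℕ × ℕ) →. List ℕ × ℕ}
    {g : List ℕ × (List ℕ × ℕ) →. Bool} (hf : Partrec f) (hg : Partrec g) {α : Type*}
    [Primcodable α] {r : α → List ℕ × ℕ} {I : α → IdealExpr} (hr : Primrec r) (hI : Primrec I)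
    (b : Bool) : Enumerable fun a => IdealAnswer f g (r a) (I a) b := by
  refine .ex (.ex (.and ?_ (.and ?_ ?_)))
  · exact (Enumerable.graph hf).comp (f := fun x : (α × (List ℕ × ℕ)) × (List ℕ × ℕ) =>
      ((deletion (r x.1.1).1, r x.1.1), x.1.2)) (by fun_prop)
  · exact (Enumerable.graph hf).comp (f := fun x : (α × (List ℕ × ℕ)) × (List ℕ × ℕ) =>
      (((I x.1.1).transducer, x.1.2), x.2)) (by fun_prop)
  · exact (Enumerable.graph hg).comp (f := fun x : (α × (List ℕ × ℕ)) × (List ℕ × ℕ) =>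
      (((I x.1.1).symbols, x.2), b)) (by fun_prop)

open Encodable (encode)

/-! ### Computing downward closures -/

/-- A state of the deterministic automata below: ideals whose union is a residual of the downward
closure, and words that generate its complement. -/
abbrev ClosureState := List IdealExpr × List (List ℕ)

/-- Only what remains must be justified by what was there before; `s'` may omit possible successors.
Omitting too much makes the third condition of `Certificate` fail. -/
def ClosureState.Step (s : ClosureState) (a : ℕ) (s' : ClosureState) : Prop :=
  (∀ I' ∈ s'.1, ∃ I ∈ s.1, IdealExpr.Step I a I') ∧ ∀ v' ∈ s'.2, ∃ v ∈ s.2, v = v' ∨ v = a :: v'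

/-- The initial state `s₀` and the reachable states `Q` witness that the automaton `A` accepts the
union of the ideals in `s₀`, and that every other word over `X` has a subword in `s₀.2`. -/
def Certificate (X : List ℕ) (A : FiniteAutomaton) (s₀ : ClosureState) (Q : List ClosureState) :
    Prop :=
  A.2.1 = encode s₀ ∧ s₀ ∈ Q ∧
  (∀ s ∈ Q, (s.1 ≠ [] ∧ encode s ∈ A.2.2) ∨ [] ∈ s.2) ∧
  (∀ s ∈ Q, ∀ a ∈ X, ∃ s' ∈ Q, (encode s, [a], encode s') ∈ A.1) ∧
  (∀ e ∈ A.1, ∃ (s : ClosureState) (a : ℕ) (s' : ClosureState),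
    e = (encode s, [a], encode s') ∧ s.Step a s') ∧
  ∀ q ∈ A.2.2, ∃ s : ClosureState, q = encode s ∧ s.1 ≠ []

theorem Certificate.step {X : List ℕ} {A : FiniteAutomaton} {s₀ : ClosureState}
    {Q : List ClosureState} (h : Certificate X A s₀ Q) {s : ClosureState} {u : List ℕ} {q : ℕ}
    (he : (encode s, u, q) ∈ A.1) : ∃ a s', u = [a] ∧ q = encode s' ∧ s.Step a s' := by
  obtain ⟨s₁, a, s', he', hs⟩ := h.2.2.2.2.1 _ he
  simp only [Prod.mk.injEq] at he'
  obtain rfl := Encodable.encode_injective he'.1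
  exact ⟨a, s', he'.2.1, he'.2.2, hs⟩

/-- The remaining ideal contains the empty word. Tracing it back along the path prepends the letters
read one by one. -/
theorem Certificate.mem_lang_of_path {X : List ℕ} {A : FiniteAutomaton} {s₀ : ClosureState}
    {Q : List ClosureState} (h : Certificate X A s₀ Q) {p q : ℕ} {w : List ℕ}
    (hw : AutPath A.1 p w q) {s s' : ClosureState} (hp : p = encode s) (hq : q = encode s')
    {I' : IdealExpr} (hI' : I' ∈ s'.1) : ∃ I ∈ s.1, w ∈ IdealExpr.lang I := by
  induction hw generalizing s with
  | nil p =>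
    obtain rfl : s = s' := Encodable.encode_injective (hp.symm.trans hq)
    exact ⟨I', hI', IdealExpr.nil_mem_lang _⟩
  | cons he _ ih =>
    subst hp
    obtain ⟨a, s₁, rfl, hs₁, hs⟩ := h.step he
    obtain ⟨I₁, hI₁, hw⟩ := ih hs₁ hq
    obtain ⟨I, hI, hstep⟩ := hs.1 I₁ hI₁
    exact ⟨I, hI, hstep.cons_mem hw⟩

theorem Certificate.exists_path {X : List ℕ} {A : FiniteAutomaton} {s₀ : ClosureState}
    {Q : List ClosureState} (h : Certificate X A s₀ Q) {w : List ℕ} (hw : ∀ a ∈ w, a ∈ X)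
    {s : ClosureState} (hs : s ∈ Q) : ∃ s' ∈ Q, AutPath A.1 (encode s) w (encode s') ∧
      ∀ v' ∈ s'.2, ∃ v ∈ s.2, ∃ x : List ℕ, v = x ++ v' ∧ x.Sublist w := by
  induction w generalizing s with
  | nil => exact ⟨s, hs, .nil _, fun v hv => ⟨v, hv, [], rfl, List.Sublist.refl _⟩⟩
  | cons a w ih =>
    rw [List.forall_mem_cons] at hw
    obtain ⟨s₁, hs₁, he⟩ := h.2.2.2.1 s hs a hw.1
    obtain ⟨s', hs', hp, hv⟩ := ih hw.2 hs₁
    refine ⟨s', hs', .cons (u := [a]) he hp, fun v' hv' => ?_⟩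
    obtain ⟨v₁, hv₁, x, rfl, hx⟩ := hv v' hv'
    obtain ⟨b, s₂, hb, hs₂, hstep⟩ := h.step he
    obtain rfl : a = b := by simpa using hb
    obtain rfl := Encodable.encode_injective hs₂
    obtain ⟨v, hv, rfl | rfl⟩ := hstep.2 _ hv₁
    · exact ⟨_, hv, x, rfl, hx.cons _⟩
    · exact ⟨_, hv, a :: x, rfl, hx.cons_cons _⟩

/-- An accepted word is traced back to an ideal inside D. A word of D can be read within `Q`; if the
state reached were not final, an excluded word would have been used up, so it would be a subword of
a word of D. -/
theorem Certificate.accepts_eq {X : List ℕ} {A : FiniteAutomaton} {s₀ : ClosureState}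
    {Q : List ClosureState} (h : Certificate X A s₀ Q) {D : Set (List ℕ)}
    (hD : IsDownwardClosedOver X D) (h₁ : ∀ I ∈ s₀.1, IdealExpr.lang I ⊆ D)
    (h₂ : ∀ v ∈ s₀.2, v ∉ D) : A.accepts = D := by
  refine Set.Subset.antisymm ?_ fun w hw => ?_
  · rintro w ⟨q, hq, hp⟩
    obtain ⟨s, rfl, hs⟩ := h.2.2.2.2.2 q hq
    obtain ⟨I', hI'⟩ := List.exists_mem_of_ne_nil _ hs
    obtain ⟨I, hI, hw⟩ := h.mem_lang_of_path hp h.1 rfl hI'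
    exact h₁ I hI hw
  · obtain ⟨s, hs, hp, hv⟩ := h.exists_path (hD.mem_alphabet w hw) h.2.1
    rcases h.2.2.1 s hs with ⟨-, hs⟩ | hs
    · exact ⟨_, hs, h.1 ▸ hp⟩
    · obtain ⟨v, hv, x, rfl, hx⟩ := hv [] hs
      rw [List.append_nil] at hv
      exact absurd (hD.down _ _ hx hw) (h₂ _ hv)

/-- `I'` can remain after ideals in `Is` have read the reversal of the given word. -/
def IdealExpr.Remains (Is : List IdealExpr) : List ℕ → IdealExpr → Prop
  | [], I' => I' ∈ Is
  | a :: u, I' => ∃ I, Remains Is u I ∧ Step I a I'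

/-- `v'` can remain after subwords of the reversal of the given word have been removed from the
left of words in `F`. -/
def SuffixRemains (F : List (List ℕ)) : List ℕ → List ℕ → Prop
  | [], v' => v' ∈ F
  | a :: u, v' => ∃ v, SuffixRemains F u v ∧ (v = v' ∨ v = a :: v')

theorem IdealExpr.Remains.mem_tails {Is : List IdealExpr} {u : List ℕ} {I : IdealExpr}
    (h : Remains Is u I) : I ∈ Is.flatMap List.tails := by
  induction u generalizing I with
  | nil => exact List.mem_flatMap.2 ⟨I, h, (List.mem_tails _ _).2 List.suffix_rfl⟩
  | cons a u ih =>
    obtain ⟨J, hJ, hI⟩ := h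
    obtain ⟨K, hK, hJK⟩ := List.mem_flatMap.1 (ih hJ)
    exact List.mem_flatMap.2 ⟨K, hK, (List.mem_tails _ _).2 (hI.suffix.trans ((List.mem_tails _ _).1 hJK))⟩

theorem SuffixRemains.mem_tails {F : List (List ℕ)} {u v : List ℕ} (h : SuffixRemains F u v) :
    v ∈ F.flatMap List.tails := by
  induction u generalizing v with
  | nil => exact List.mem_flatMap.2 ⟨v, h, (List.mem_tails _ _).2 List.suffix_rfl⟩
  | cons a u ih =>
    obtain ⟨v', hv', rfl | rfl⟩ := h
    · exact ih hv'
    · obtain ⟨f, hf, h⟩ := List.mem_flatMap.1 (ih hv')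
      exact List.mem_flatMap.2
        ⟨f, hf, (List.mem_tails _ _).2 ((List.suffix_cons a v).trans ((List.mem_tails _ _).1 h))⟩

theorem IdealExpr.Remains.exists_of_mem_lang {Is : List IdealExpr} {u w : List ℕ} {I : IdealExpr}
    (h : Remains Is u I) (hw : w ∈ I.lang) : ∃ I', Remains Is (w.reverse ++ u) I' := by
  induction w generalizing u I with
  | nil => exact ⟨I, h⟩
  | cons a w ih =>
    obtain ⟨I', hI, hw⟩ := exists_step hw
    obtain ⟨I'', h''⟩ := ih (u := a :: u) ⟨I, h, hI⟩ hw
    exact ⟨I'', by simpa using h''⟩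

theorem SuffixRemains.nil_of_sublist {F : List (List ℕ)} {u v w : List ℕ}
    (h : SuffixRemains F u v) (hw : v.Sublist w) : SuffixRemains F (w.reverse ++ u) [] := by
  induction hw generalizing u with
  | slnil => exact h
  | @cons v w a _ ih => simpa using ih (u := a :: u) ⟨v, h, .inl rfl⟩
  | @cons_cons v w a _ ih => simpa using ih (u := a :: u) ⟨a :: v, h, .inr rfl⟩

/-- A subset construction: the state records all ideals and all suffixes of forbidden words that can
remain. If the word read is in D, some ideal remains; otherwise a forbidden word has been removed
entirely. -/
theorem exists_certificate {X : List ℕ} {D : Set (List ℕ)} (hD : IsDownwardClosedOver X D) :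
    ∃ A s₀ Q, Certificate X A s₀ Q ∧ (∀ I ∈ s₀.1, IdealExpr.lang I ⊆ D) ∧ ∀ v ∈ s₀.2, v ∉ D := by
  classical
  obtain ⟨Is, hIs⟩ := hD.exists_ideals
  obtain ⟨F, hFD, hF⟩ := exists_forbidden X D
  -- The word read is stored in reverse, so reading a letter is a cons. Filtering fixed lists yields
  -- canonical representatives, and only finitely many of them.
  let st : List ℕ → ClosureState := fun u =>
    ((Is.flatMap List.tails).filter fun I => IdealExpr.Remains Is u I,
      (F.flatMap List.tails).filter fun v => SuffixRemains F u v)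
  have hst₁ : ∀ u I, I ∈ (st u).1 ↔ IdealExpr.Remains Is u I := fun u I => by
    simp only [st, List.mem_filter, decide_eq_true_eq]
    exact ⟨fun h => h.2, fun h => ⟨h.mem_tails, h⟩⟩
  have hst₂ : ∀ u v, v ∈ (st u).2 ↔ SuffixRemains F u v := fun u v => by
    simp only [st, List.mem_filter, decide_eq_true_eq]
    exact ⟨fun h => h.2, fun h => ⟨h.mem_tails, h⟩⟩
  have hstep : ∀ u a, (st u).Step a (st (a :: u)) := by
    refine fun u a => ⟨fun I' hI' => ?_, fun v' hv' => ?_⟩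
    · obtain ⟨I, hI, h⟩ := (hst₁ _ _).1 hI'
      exact ⟨I, (hst₁ _ _).2 hI, h⟩
    · obtain ⟨v, hv, h⟩ := (hst₂ _ _).1 hv'
      exact ⟨v, (hst₂ _ _).2 hv, h⟩
  have hfin : {s | ∃ u, (∀ a ∈ u, a ∈ X) ∧ s = st u}.Finite := by
    refine Set.Finite.subset (List.finite_toSet ((Is.flatMap List.tails).sublists.product
      (F.flatMap List.tails).sublists)) ?_
    rintro s ⟨u, -, rfl⟩
    exact List.mem_product.2 ⟨List.mem_sublists.2 List.filter_sublist,
      List.mem_sublists.2 List.filter_sublist⟩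
  let Q := hfin.toFinset.toList
  have hQ : ∀ s, s ∈ Q ↔ ∃ u, (∀ a ∈ u, a ∈ X) ∧ s = st u := fun s => by simp [Q]
  refine ⟨(Q.flatMap fun s => X.flatMap fun a => (Q.filter fun s' => s.Step a s').map fun s' =>
    (encode s, [a], encode s'), encode (st []), (Q.filter fun s => s.1 ≠ []).map encode), st [], Q,
    ⟨rfl, (hQ _).2 ⟨[], by simp, rfl⟩, ?_, ?_, ?_, ?_⟩, ?_, ?_⟩
  · intro s hs
    obtain ⟨u, hu, rfl⟩ := (hQ s).1 hs
    by_cases huD : u.reverse ∈ D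
    · obtain ⟨I, hI, hw⟩ := (hIs _).1 huD
      obtain ⟨I', hI'⟩ := IdealExpr.Remains.exists_of_mem_lang (Is := Is) (u := []) hI hw
      rw [List.reverse_reverse, List.append_nil, ← hst₁] at hI'
      have hne : (st u).1 ≠ [] := List.ne_nil_of_mem hI'
      exact .inl ⟨hne, List.mem_map_of_mem (List.mem_filter.2 ⟨hs, by simpa using hne⟩)⟩
    · obtain ⟨f, hf, hfu⟩ := hF u.reverse (by simpa using hu) huD
      have := SuffixRemains.nil_of_sublist (F := F) (u := []) hf hfu
      rw [List.reverse_reverse, List.append_nil, ← hst₂] at this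
      exact .inr this
  · intro s hs a ha
    obtain ⟨u, hu, rfl⟩ := (hQ s).1 hs
    have hs' : st (a :: u) ∈ Q := (hQ _).2 ⟨a :: u, List.forall_mem_cons.2 ⟨ha, hu⟩, rfl⟩
    refine ⟨st (a :: u), hs', List.mem_flatMap.2 ⟨_, hs, List.mem_flatMap.2 ⟨a, ha, ?_⟩⟩⟩
    exact List.mem_map.2 ⟨_, List.mem_filter.2 ⟨hs', by simpa using hstep u a⟩, rfl⟩
  · intro e he
    obtain ⟨s, -, he⟩ := List.mem_flatMap.1 he
    obtain ⟨a, -, he⟩ := List.mem_flatMap.1 he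
    obtain ⟨s', hs', rfl⟩ := List.mem_map.1 he
    exact ⟨s, a, s', rfl, by simpa using (List.mem_filter.1 hs').2⟩
  · intro q hq
    obtain ⟨s, hs, rfl⟩ := List.mem_map.1 hq
    exact ⟨s, rfl, by simpa using (List.mem_filter.1 hs).2⟩
  · intro I hI w hw
    exact (hIs w).2 ⟨I, (hst₁ _ _).1 hI, hw⟩
  · intro v hv
    exact hFD v ((hst₂ _ _).1 hv)

theorem enumerable_idealStep {α : Type*} [Primcodable α] {I I' : α → IdealExpr} {a : α → ℕ}
    (hI : Primrec I) (ha : Primrec a) (hI' : Primrec I') :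
    Enumerable fun x => IdealExpr.Step (I x) (a x) (I' x) := by
  refine .ex (.ex (.ex (.and (.of_primrec (primrecPred_eq (by fun_prop) (by fun_prop)))
    (.or (.and (.of_primrec (primrecPred_mem (by fun_prop) (by fun_prop)))
        (.of_primrec (primrecPred_eq (by fun_prop) (by fun_prop))))
      (.and (.of_primrec (primrecPred_eq (by fun_prop) (by fun_prop)))
        (.of_primrec (primrecPred_eq (by fun_prop) (by fun_prop))))))))

theorem enumerable_stateStep {α : Type*} [Primcodable α] {s s' : α → ClosureState} {a : α → ℕ}
    (hs : Primrec s) (ha : Primrec a) (hs' : Primrec s') :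
    Enumerable fun x => (s x).Step (a x) (s' x) := by
  refine .and (.forall_mem (by fun_prop) (.exists_mem (by fun_prop)
    (enumerable_idealStep (by fun_prop) (by fun_prop) (by fun_prop))))
    (.forall_mem (by fun_prop) (.exists_mem (by fun_prop)
      (.or (.of_primrec (primrecPred_eq (by fun_prop) (by fun_prop)))
        (.of_primrec (primrecPred_eq (by fun_prop) (by fun_prop))))))

theorem enumerable_certificate {α : Type*} [Primcodable α] {X : α → List ℕ}
    {A : α → FiniteAutomaton} {s₀ : α → ClosureState} {Q : α → List ClosureState}
    (hX : Primrec X) (hA : Primrec A) (hs : Primrec s₀) (hQ : Primrec Q) :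
    Enumerable fun x => Certificate (X x) (A x) (s₀ x) (Q x) := by
  refine .and (.of_primrec (primrecPred_eq (by fun_prop) (by fun_prop)))
    (.and (.of_primrec (primrecPred_mem (by fun_prop) (by fun_prop))) (.and ?_ (.and ?_
      (.and ?_ ?_))))
  · exact .forall_mem (by fun_prop) (.or (.and
      (.of_primrec (primrecPred_ne (by fun_prop) (by fun_prop)))
      (.of_primrec (primrecPred_mem (by fun_prop) (by fun_prop))))
      (.of_primrec (primrecPred_mem (by fun_prop) (by fun_prop))))
  · exact .forall_mem (by fun_prop) (.forall_mem (by fun_prop) (.exists_mem (by fun_prop)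
      (.of_primrec (primrecPred_mem (by fun_prop) (by fun_prop)))))
  · exact .forall_mem (by fun_prop) (.ex (.ex (.ex (.and
      (.of_primrec (primrecPred_eq (by fun_prop) (by fun_prop)))
      (enumerable_stateStep (by fun_prop) (by fun_prop) (by fun_prop))))))
  · exact .forall_mem (by fun_prop) (.ex (.and
      (.of_primrec (primrecPred_eq (by fun_prop) (by fun_prop)))
      (.of_primrec (primrecPred_ne (by fun_prop) (by fun_prop)))))

@[fun_prop] theorem primrec_ofWord {α : Type*} [Primcodable α] {f : α → List ℕ}
    (hf : Primrec f) : Primrec fun a => IdealExpr.ofWord (f a) := by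
  unfold IdealExpr.ofWord
  fun_prop

theorem isDownwardClosedOver_downwardClosure (C : LanguageClass) {r : List ℕ × ℕ}
    (hr : r ∈ C.rep) : IsDownwardClosedOver r.1 (downwardClosure (C.lang r)) :=
  ⟨fun _ ⟨v, hv, h⟩ a ha => C.lang_over r hr v hv a (h.subset ha), downwardClosure_down _⟩

theorem LanguageClass.downwardClosuresComputable_of_supDecidable {C : LanguageClass}
    (hC : C.IsFullTrio) (hS : C.SUPDecidable) : C.DownwardClosuresComputable := by
  obtain ⟨f, hf, hf'⟩ := hC
  obtain ⟨g, hg, hg'⟩ := hS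
  let R : List ℕ × ℕ → FiniteAutomaton → Prop := fun r A =>
    ∃ s₀ Q, Certificate r.1 A s₀ Q ∧ (∀ I ∈ s₀.1, IdealAnswer f g r I true) ∧
      ∀ v ∈ s₀.2, IdealAnswer f g r (IdealExpr.ofWord v) false
  have hR : Enumerable fun x : (List ℕ × ℕ) × FiniteAutomaton => R x.1 x.2 := by
    refine .ex (.ex (.and
      (enumerable_certificate (by fun_prop) (by fun_prop) (by fun_prop) (by fun_prop))
      (.and (.forall_mem (by fun_prop) ?_) (.forall_mem (by fun_prop) ?_))))
    · exact enumerable_idealAnswer hf hg (by fun_prop) (by fun_prop) true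
    · exact enumerable_idealAnswer hf hg (by fun_prop) (by fun_prop) false
  have hans : ∀ r ∈ C.rep, ∀ I, (IdealAnswer f g r I true ↔
      IdealExpr.lang I ⊆ downwardClosure (C.lang r)) ∧ (IdealAnswer f g r I false ↔
      ¬ IdealExpr.lang I ⊆ downwardClosure (C.lang r)) := by
    intro r hr I
    obtain ⟨b, hb, h⟩ := idealAnswer_spec hf' hg' hr I
    rw [h, h, ← hb]
    cases b <;> simp
  -- Membership of a word is a special case of inclusion of an ideal.
  have hword : ∀ (L : Language ℕ) v, IdealExpr.lang (IdealExpr.ofWord v) ⊆ downwardClosure L ↔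
      v ∈ downwardClosure L := fun L v => by
    rw [IdealExpr.lang_subset_iff (downwardClosure_down L)]
    simp only [IdealExpr.word_ofWord, forall_const]
    exact Iff.rfl
  obtain ⟨F, hF, hFR, hdom⟩ := hR.exists_partrec
  refine ⟨F, hF, fun r hr => ?_⟩
  have hD := isDownwardClosedOver_downwardClosure C hr
  obtain ⟨A, s₀, Q, hcert, hI, hv⟩ := exists_certificate hD
  have hRA : R r A := ⟨s₀, Q, hcert, fun I hI' => (hans r hr I).1.2 (hI I hI'),
    fun v hv' => (hans r hr _).2.2 ((hword _ _).not.2 (hv v hv'))⟩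
  have hd := hdom r ⟨A, hRA⟩
  refine ⟨(F r).get hd, Part.get_mem hd, ?_⟩
  -- The automaton found need not be the one constructed above; any certificate is sound.
  obtain ⟨s₀, Q, hcert, hI, hv⟩ := hFR r _ (Part.get_mem hd)
  exact hcert.accepts_eq hD (fun I hI' => (hans r hr I).1.1 (hI I hI'))
    fun v hv' => (hword _ _).not.1 ((hans r hr _).2.1 (hv v hv'))


/-! ### Deciding simultaneous unboundedness for a finite automaton -/

theorem AutPath.append {E : List (ℕ × List ℕ × ℕ)} {p q s : ℕ} {u v : List ℕ}
    (h₁ : AutPath E p u q) (h₂ : AutPath E q v s) : AutPath E p (u ++ v) s := by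
  induction h₁ with
  | nil => exact h₂
  | cons he _ ih => rw [List.append_assoc]; exact .cons he (ih h₂)

theorem AutPath.single {E : List (ℕ × List ℕ × ℕ)} {p q : ℕ} {u : List ℕ} (h : (p, u, q) ∈ E) :
    AutPath E p u q := by
  simpa using AutPath.cons h (.nil q)

/-- Some edge leads from `p` to `q`. -/
def AutEdge (E : List (ℕ × List ℕ × ℕ)) (p q : ℕ) : Prop := ∃ u, (p, u, q) ∈ E

theorem AutPath.reflTransGen {E : List (ℕ × List ℕ × ℕ)} {p q : ℕ} {w : List ℕ}
    (h : AutPath E p w q) : Relation.ReflTransGen (AutEdge E) p q := by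
  induction h with
  | nil => exact .refl
  | cons he _ ih => exact .head ⟨_, he⟩ ih

theorem exists_autPath_of_reflTransGen {E : List (ℕ × List ℕ × ℕ)} {p q : ℕ}
    (h : Relation.ReflTransGen (AutEdge E) p q) : ∃ w, AutPath E p w q := by
  induction h using Relation.ReflTransGen.head_induction_on with
  | refl => exact ⟨[], .nil q⟩
  | head he _ ih =>
    obtain ⟨w, hw⟩ := ih
    obtain ⟨u, hu⟩ := he
    exact ⟨u ++ w, .cons hu hw⟩

/-- Some closed path at `q` reads the letter `a`. -/
def HasLoop (E : List (ℕ × List ℕ × ℕ)) (a q : ℕ) : Prop :=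
  ∃ e ∈ E, a ∈ e.2.1 ∧ Relation.ReflTransGen (AutEdge E) q e.1 ∧
    Relation.ReflTransGen (AutEdge E) e.2.2 q

theorem hasLoop_iff {E : List (ℕ × List ℕ × ℕ)} {a q : ℕ} :
    HasLoop E a q ↔ ∃ y, AutPath E q y q ∧ a ∈ y := by
  constructor
  · rintro ⟨e, he, ha, h₁, h₂⟩
    obtain ⟨w₁, h₁⟩ := exists_autPath_of_reflTransGen h₁
    obtain ⟨w₂, h₂⟩ := exists_autPath_of_reflTransGen h₂
    exact ⟨w₁ ++ (e.2.1 ++ w₂), h₁.append (.cons he h₂), by simp [ha]⟩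
  · rintro ⟨y, hy, ha⟩
    have : ∀ p s w, AutPath E p w s → a ∈ w → ∃ e ∈ E, a ∈ e.2.1 ∧
        Relation.ReflTransGen (AutEdge E) p e.1 ∧ Relation.ReflTransGen (AutEdge E) e.2.2 s := by
      intro p s w h ha
      induction h with
      | nil => cases ha
      | @cons p q s u w he hp ih =>
        rcases List.mem_append.1 ha with ha | ha
        · exact ⟨_, he, ha, .refl, hp.reflTransGen⟩
        · obtain ⟨e, he', hae, h₁, h₂⟩ := ih ha
          exact ⟨e, he', hae, .head ⟨u, he⟩ h₁, h₂⟩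
    exact this _ _ _ hy ha

theorem HasLoop.exists_replicate {E : List (ℕ × List ℕ × ℕ)} {a q : ℕ} (h : HasLoop E a q)
    (k : ℕ) : ∃ y, AutPath E q y q ∧ (List.replicate k a).Sublist y := by
  obtain ⟨y, hy, ha⟩ := hasLoop_iff.1 h
  induction k with
  | zero => exact ⟨[], .nil q, List.Sublist.refl _⟩
  | succ k ih =>
    obtain ⟨z, hz, hk⟩ := ih
    exact ⟨y ++ z, hy.append hz, (List.singleton_sublist.2 ha).append hk⟩

/-- In the state `c.1`, with the letters `c.2` still to be pumped, follow an edge or pump a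
letter by a loop. -/
def PumpStep (E : List (ℕ × List ℕ × ℕ)) (c c' : ℕ × List ℕ) : Prop :=
  (AutEdge E c.1 c'.1 ∧ c.2 = c'.2) ∨ ∃ a, c.2 = a :: c'.2 ∧ c.1 = c'.1 ∧ HasLoop E a c.1

/-- All letters in `as` can be pumped in turn along an accepting path. -/
def Pumpable (A : FiniteAutomaton) (as : List ℕ) : Prop :=
  ∃ f ∈ A.2.2, Relation.ReflTransGen (PumpStep A.1) (A.2.1, as) (f, [])

theorem exists_path_of_pumpStep {E : List (ℕ × List ℕ × ℕ)} {c : ℕ × List ℕ} {f : ℕ}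
    (h : Relation.ReflTransGen (PumpStep E) c (f, [])) (k : ℕ) :
    ∃ w, (blockWord c.2 k).Sublist w ∧ AutPath E c.1 w f := by
  induction h using Relation.ReflTransGen.head_induction_on with
  | refl => exact ⟨[], List.Sublist.refl _, .nil f⟩
  | head hs _ ih =>
    obtain ⟨w, hw, hp⟩ := ih
    rcases hs with ⟨⟨u, hu⟩, h⟩ | ⟨a, h, h', hl⟩
    · exact ⟨u ++ w, h ▸ hw.trans (List.sublist_append_right _ _), .cons hu hp⟩
    · obtain ⟨y, hy, hk⟩ := hl.exists_replicate k
      rw [← h'] at hp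
      exact ⟨y ++ w, h ▸ hk.append hw, hy.append hp⟩

theorem pumpStep_of_path {E : List (ℕ × List ℕ × ℕ)} {p q : ℕ} {w : List ℕ}
    (h : AutPath E p w q) (as : List ℕ) :
    Relation.ReflTransGen (PumpStep E) (p, as) (q, as) := by
  induction h with
  | nil => exact .refl
  | @cons p q s u w he _ ih => exact .head (b := (q, as)) (.inl ⟨⟨u, he⟩, rfl⟩) ih

/-- Stop after the first edge that contributes to the embedded word. It covers fewer than M letters,
all of them from the initial block of k + M letters `a`, so at least k of these are left. -/
theorem AutPath.split_first {E : List (ℕ × List ℕ × ℕ)} {M : ℕ}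
    (hM : ∀ e ∈ E, e.2.1.length < M) {p f a k : ℕ} {v w : List ℕ} (h : AutPath E p w f)
    (hpos : 0 < M) (hw : (List.replicate (k + M) a ++ v).Sublist w) :
    ∃ q ∈ E.map (fun e => e.2.2), ∃ x y, AutPath E p x q ∧ a ∈ x ∧ AutPath E q y f ∧
      (List.replicate k a ++ v).Sublist y := by
  induction h with
  | nil =>
    have := hw.length_le
    simp at this
    omega
  | @cons p q s u w he hp ih =>
    obtain ⟨l₁, l₂, hl, h₁, h₂⟩ := List.sublist_append_iff.1 hw
    have hlen : l₁.length < M := h₁.length_le.trans_lt (hM _ he)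
    have e₁ : l₁ = List.replicate l₁.length a := by
      have := congrArg (List.take l₁.length) hl
      rw [List.take_left, List.take_append_of_le_length (by simp; omega), List.take_replicate,
        min_eq_left (by omega)] at this
      exact this.symm
    have e₂ : l₂ = List.replicate (k + M - l₁.length) a ++ v := by
      have := congrArg (List.drop l₁.length) hl
      rw [List.drop_left, List.drop_append_of_le_length (by simp; omega),
        List.drop_replicate] at this
      exact this.symm
    rcases Nat.eq_zero_or_pos l₁.length with h0 | h0
    · rw [h0, Nat.sub_zero] at e₂
      obtain ⟨q', hq', x, y, hx, hax, hy, hv⟩ := ih (e₂ ▸ h₂)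
      exact ⟨q', hq', u ++ x, y, .cons he hx, List.mem_append_right _ hax, hy, hv⟩
    · refine ⟨q, List.mem_map_of_mem he, u, w, .single he, ?_, hp, ?_⟩
      · refine h₁.subset ?_
        rw [e₁]
        exact List.mem_replicate.2 ⟨by omega, rfl⟩
      · refine List.Sublist.trans ?_ h₂
        rw [e₂]
        exact (List.replicate_sublist_replicate a |>.2 (by omega)).append (List.Sublist.refl _)

/-- Arbitrarily long blocks can be read, as a subword, on the way from `p` to `F`. -/
def Unbounded (E : List (ℕ × List ℕ × ℕ)) (F : List ℕ) (as : List ℕ) (p : ℕ) : Prop :=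
  ∀ k, ∃ w, ∃ f ∈ F, (blockWord as k).Sublist w ∧ AutPath E p w f

theorem Unbounded.exists_next {E : List (ℕ × List ℕ × ℕ)} {F as : List ℕ} {a p : ℕ}
    (h : Unbounded E F (a :: as) p) : ∃ q ∈ E.map (fun e => e.2.2), ∃ x, AutPath E p x q ∧ a ∈ x ∧
      Unbounded E F (a :: as) q := by
  obtain ⟨M, hpos, hM⟩ : ∃ M, 0 < M ∧ ∀ e ∈ E, e.2.1.length < M := by
    refine ⟨(E.map fun e => e.2.1.length).sum + 1, Nat.succ_pos _, fun e he => ?_⟩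
    exact Nat.lt_succ_of_le (List.le_sum_of_mem (List.mem_map_of_mem he))
  have key : ∀ k, ∃ q ∈ E.map (fun e => e.2.2), ∃ x, AutPath E p x q ∧ a ∈ x ∧
      ∃ y, ∃ f ∈ F, (blockWord (a :: as) k).Sublist y ∧ AutPath E q y f := by
    intro k
    obtain ⟨w, f, hf, hw, hp⟩ := h (k + M)
    have hw' : (List.replicate (k + M) a ++ blockWord as k).Sublist w :=
      ((List.Sublist.refl _).append (blockWord_mono as (Nat.le_add_right k M))).trans hw
    obtain ⟨q, hq, x, y, hx, hax, hy, hv⟩ := hp.split_first hM hpos hw'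
    exact ⟨q, hq, x, hx, hax, y, f, hf, hv, hy⟩
  choose q hq x hx hax y f hf hy hp using key
  -- Pigeonhole: one state serves infinitely many k, hence all k by monotonicity.
  have : Finite {s // s ∈ E.map (fun e => e.2.2)} := (List.finite_toSet _).to_subtype
  obtain ⟨⟨s, hs⟩, hinf⟩ := Finite.exists_infinite_fiber
    fun k => (⟨q k, hq k⟩ : {s // s ∈ E.map (fun e => e.2.2)})
  have hinf' := Set.infinite_coe_iff.1 hinf
  have hfib : ∀ k, ∃ n, k < n ∧ q n = s := fun k => by
    obtain ⟨n, hn, hkn⟩ := hinf'.exists_gt k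
    exact ⟨n, hkn, congrArg Subtype.val hn⟩
  refine ⟨s, hs, ?_⟩
  obtain ⟨n, -, rfl⟩ := hfib 0
  refine ⟨x n, hx n, hax n, fun k => ?_⟩
  obtain ⟨m, hkm, hm⟩ := hfib k
  exact ⟨y m, f m, hf m, (blockWord_mono _ hkm.le).trans (hy m), hm ▸ hp m⟩

/-- Iterating `Unbounded.exists_next` gives an infinite walk through unbounded states, each segment
reading `a`. A repeated state closes the loop. -/
theorem Unbounded.exists_loop {E : List (ℕ × List ℕ × ℕ)} {F as : List ℕ} {a p : ℕ}
    (h : Unbounded E F (a :: as) p) : ∃ q x, AutPath E p x q ∧ HasLoop E a q ∧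
      Unbounded E F (a :: as) q := by
  choose next hmem x hx hax hnext using
    fun s : {s // Unbounded E F (a :: as) s} => s.2.exists_next
  let t : ℕ → {s // Unbounded E F (a :: as) s} := fun n =>
    Nat.rec ⟨p, h⟩ (fun _ s => ⟨next s, hnext s⟩) n
  have hpath : ∀ m n, ∃ w, AutPath E (t m).1 w (t (m + n)).1 ∧ (0 < n → a ∈ w) := by
    intro m n
    induction n with
    | zero => exact ⟨[], .nil _, fun h => absurd h (lt_irrefl 0)⟩
    | succ n ih =>
      obtain ⟨w, hw, -⟩ := ih
      exact ⟨w ++ x (t (m + n)), hw.append (hx _), fun _ => List.mem_append_right _ (hax _)⟩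
  have : Finite {s // s ∈ E.map (fun e => e.2.2)} := (List.finite_toSet _).to_subtype
  -- The shift by one skips the start `p`, which need not be the target of an edge.
  obtain ⟨m, n, hmn, heq⟩ := Finite.exists_ne_map_eq_of_infinite
    fun k => (⟨(t (k + 1)).1, hmem (t k)⟩ : {s // s ∈ E.map (fun e => e.2.2)})
  have heq' : (t (m + 1)).1 = (t (n + 1)).1 := (Subtype.mk.injEq _ _ _ _).mp heq
  have hloop : ∀ m n, m < n → (t (m + 1)).1 = (t (n + 1)).1 → HasLoop E a (t (m + 1)).1 := by
    intro m n hmn heq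
    obtain ⟨w, hw, ha⟩ := hpath (m + 1) (n - m)
    rw [show m + 1 + (n - m) = n + 1 by omega, ← heq] at hw
    exact hasLoop_iff.2 ⟨w, hw, ha (by omega)⟩
  have hl : HasLoop E a (t (m + 1)).1 := by
    rcases lt_or_gt_of_ne hmn with hlt | hlt
    · exact hloop m n hlt heq'
    · exact heq' ▸ hloop n m hlt heq'.symm
  obtain ⟨w, hw, -⟩ := hpath 0 (m + 1)
  rw [Nat.zero_add] at hw
  exact ⟨_, w, hw, hl, (t (m + 1)).2⟩

theorem Unbounded.exists_pumpStep {E : List (ℕ × List ℕ × ℕ)} {F as : List ℕ} {p : ℕ}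
    (h : Unbounded E F as p) :
    ∃ f ∈ F, Relation.ReflTransGen (PumpStep E) (p, as) (f, []) := by
  induction as generalizing p with
  | nil =>
    obtain ⟨w, f, hf, -, hp⟩ := h 0
    exact ⟨f, hf, pumpStep_of_path hp []⟩
  | cons a as ih =>
    obtain ⟨q, x, hx, hl, hq⟩ := h.exists_loop
    have hq' : Unbounded E F as q := fun k => by
      obtain ⟨w, f, hf, hw, hp⟩ := hq k
      exact ⟨w, f, hf, (List.sublist_append_right _ _).trans hw, hp⟩
    obtain ⟨f, hf, hr⟩ := ih hq'
    exact ⟨f, hf, (pumpStep_of_path hx _).trans (.head (b := (q, as)) (.inr ⟨a, rfl, rfl, hl⟩) hr)⟩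

theorem pumpable_iff {A : FiniteAutomaton}
    (hA : ∀ u v : List ℕ, u.Sublist v → v ∈ A.accepts → u ∈ A.accepts) {as : List ℕ} :
    Pumpable A as ↔ ∀ k, blockWord as k ∈ A.accepts := by
  constructor
  · rintro ⟨f, hf, h⟩ k
    obtain ⟨w, hw, hp⟩ := exists_path_of_pumpStep h k
    exact hA _ _ hw ⟨f, hf, hp⟩
  · intro h
    refine Unbounded.exists_pumpStep fun k => ?_
    obtain ⟨f, hf, hp⟩ := h k
    exact ⟨_, f, hf, List.Sublist.refl _, hp⟩

/-- A finite set of configurations, each a state and a word read so far, that shows that the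
automaton does not accept `a₁^k ⋯ aₙ^k` for some `k`. -/
def BlockRejected (A : FiniteAutomaton) (as : List ℕ) : Prop :=
  ∃ (k : ℕ) (S : List (ℕ × List ℕ)), (A.2.1, []) ∈ S ∧
    (∀ s ∈ S, ∀ e ∈ A.1, e.1 ≠ s.1 ∨ (e.2.2, s.2 ++ e.2.1) ∈ S ∨
      (blockWord as k).length < (s.2 ++ e.2.1).length) ∧
    ∀ f ∈ A.2.2, (f, blockWord as k) ∉ S

theorem finite_words (X : List ℕ) (n : ℕ) :
    {w : List ℕ | (∀ a ∈ w, a ∈ X) ∧ w.length ≤ n}.Finite := by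
  have : Finite {a // a ∈ X} := (List.finite_toSet X).to_subtype
  refine ((List.finite_length_le {a // a ∈ X} n).image (List.map Subtype.val)).subset ?_
  rintro w ⟨hw, hn⟩
  exact ⟨w.attach.map fun a => ⟨a.1, hw a.1 a.2⟩, by simpa using hn, by simp⟩

theorem AutPath.mem_labels {E : List (ℕ × List ℕ × ℕ)} {p q a : ℕ} {w : List ℕ}
    (h : AutPath E p w q) (ha : a ∈ w) : a ∈ E.flatMap fun e => e.2.1 := by
  induction h with
  | nil => cases ha
  | cons he _ ih =>
    rcases List.mem_append.1 ha with ha | ha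
    · exact List.mem_flatMap.2 ⟨_, he, ha⟩
    · exact ih ha

theorem AutPath.mem_targets {E : List (ℕ × List ℕ × ℕ)} {p q : ℕ} {w : List ℕ}
    (h : AutPath E p w q) : q ∈ p :: E.map fun e => e.2.2 := by
  induction h with
  | nil => exact List.mem_cons_self
  | cons he _ ih =>
    rcases List.mem_cons.1 ih with rfl | ih
    · exact List.mem_cons_of_mem _ (List.mem_map.2 ⟨_, he, rfl⟩)
    · exact List.mem_cons_of_mem _ ih

/-- Any such set contains every configuration reached by a word no longer than the block.
Conversely, all these configurations form a finite set, even with edges that read the empty word. -/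
theorem blockRejected_iff {A : FiniteAutomaton} {as : List ℕ} :
    BlockRejected A as ↔ ∃ k, blockWord as k ∉ A.accepts := by
  refine exists_congr fun k => ⟨?_, fun h => ?_⟩
  · rintro ⟨S, h₀, hS, hF⟩ ⟨f, hf, hp⟩
    have : ∀ p w q x, AutPath A.1 p w q → (p, x) ∈ S →
        (x ++ w).length ≤ (blockWord as k).length → (q, x ++ w) ∈ S := by
      intro p w q x h
      induction h generalizing x with
      | nil => exact fun h _ => by simpa using h
      | cons he _ ih =>
        intro hx hlen
        rw [← List.append_assoc] at hlen ⊢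
        refine ih _ ?_ hlen
        rcases hS _ hx _ he with h | h | h
        · exact absurd rfl h
        · exact h
        · rw [List.length_append] at hlen
          exact absurd h (Nat.not_lt.2 (le_of_add_le_left hlen))
    exact hF f hf (this _ _ _ [] hp h₀ le_rfl)
  · have hfin : {s : ℕ × List ℕ | AutPath A.1 A.2.1 s.2 s.1 ∧
        s.2.length ≤ (blockWord as k).length}.Finite := by
      refine ((List.finite_toSet (A.2.1 :: A.1.map fun e => e.2.2)).prod
        (finite_words (A.1.flatMap fun e => e.2.1) (blockWord as k).length)).subset ?_
      rintro ⟨p, x⟩ ⟨hp, hx⟩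
      exact ⟨hp.mem_targets, fun a ha => hp.mem_labels ha, hx⟩
    have hmem : ∀ s, s ∈ hfin.toFinset.toList ↔ AutPath A.1 A.2.1 s.2 s.1 ∧
        s.2.length ≤ (blockWord as k).length := fun s => by simp
    refine ⟨hfin.toFinset.toList, (hmem _).2 ⟨.nil _, Nat.zero_le _⟩, fun s hs e he => ?_,
      fun f hf hS => h ⟨f, hf, ((hmem _).1 hS).1⟩⟩
    by_cases hes : e.1 = s.1
    · rcases le_or_gt (s.2 ++ e.2.1).length (blockWord as k).length with hle | hlt
      · refine .inr (.inl ((hmem _).2 ⟨((hmem s).1 hs).1.append (.single ?_), hle⟩))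
        rw [← hes]
        exact he
      · exact .inr (.inr hlt)
    · exact .inl hes

@[fun_prop] theorem primrec_blockWord {α : Type*} [Primcodable α] {as : α → List ℕ} {k : α → ℕ}
    (has : Primrec as) (hk : Primrec k) : Primrec fun x => blockWord (as x) (k x) := by
  have h : Primrec fun x => (as x).flatMap fun a => (List.range (k x)).map fun _ => a := by
    refine Primrec.list_flatMap has (Primrec₂.mk ?_)
    fun_prop
  refine h.of_eq fun x => ?_
  induction as x with
  | nil => rfl
  | cons a l ih => rw [List.flatMap_cons, ih, blockWord]; simp

theorem enumerable_reflTransGen_autEdge {α : Type*} [Primcodable α]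
    {E : α → List (ℕ × List ℕ × ℕ)} {p q : α → ℕ} (hE : Primrec E) (hp : Primrec p)
    (hq : Primrec q) : Enumerable fun x => Relation.ReflTransGen (AutEdge (E x)) (p x) (q x) := by
  have h : Enumerable fun x : List (ℕ × List ℕ × ℕ) × ℕ × ℕ => AutEdge x.1 x.2.1 x.2.2 :=
    .ex (.of_primrec (primrecPred_mem (by fun_prop) (by fun_prop)))
  exact (Enumerable.reflTransGen h).comp (f := fun x => (E x, p x, q x)) (by fun_prop)

theorem enumerable_pumpable {α : Type*} [Primcodable α] {A : α → FiniteAutomaton}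
    {as : α → List ℕ} (hA : Primrec A) (has : Primrec as) :
    Enumerable fun x => Pumpable (A x) (as x) := by
  have h : Enumerable fun x : List (ℕ × List ℕ × ℕ) × (ℕ × List ℕ) × (ℕ × List ℕ) =>
      PumpStep x.1 x.2.1 x.2.2 := by
    refine .or (.and (.ex (.of_primrec (primrecPred_mem (by fun_prop) (by fun_prop))))
      (.of_primrec (primrecPred_eq (by fun_prop) (by fun_prop))))
      (.ex (.and (.of_primrec (primrecPred_eq (by fun_prop) (by fun_prop)))
      (.and (.of_primrec (primrecPred_eq (by fun_prop) (by fun_prop)))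
      (.exists_mem (by fun_prop) (.and (.of_primrec (primrecPred_mem (by fun_prop) (by fun_prop)))
      (.and (enumerable_reflTransGen_autEdge (by fun_prop) (by fun_prop) (by fun_prop))
        (enumerable_reflTransGen_autEdge (by fun_prop) (by fun_prop) (by fun_prop))))))))
  refine .exists_mem (by fun_prop) ?_
  exact (Enumerable.reflTransGen h).comp
    (f := fun x : α × ℕ => ((A x.1).1, ((A x.1).2.1, as x.1), (x.2, []))) (by fun_prop)

theorem enumerable_blockRejected {α : Type*} [Primcodable α] {A : α → FiniteAutomaton}
    {as : α → List ℕ} (hA : Primrec A) (has : Primrec as) :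
    Enumerable fun x => BlockRejected (A x) (as x) := by
  refine .ex (.ex (.and (.of_primrec (primrecPred_mem (by fun_prop) (by fun_prop))) (.and
    (.forall_mem (by fun_prop) (.forall_mem (by fun_prop) (.or
      (.of_primrec (primrecPred_ne (by fun_prop) (by fun_prop))) (.or
      (.of_primrec (primrecPred_mem (by fun_prop) (by fun_prop))) (.of_primrec ?_)))))
    (.forall_mem (by fun_prop) (.of_primrec
      (primrecPred_mem (by fun_prop) (by fun_prop)).not)))))
  exact Primrec.nat_lt.comp (by fun_prop) (by fun_prop)

theorem LanguageClass.supDecidable_of_downwardClosuresComputable {C : LanguageClass}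
    (hC : C.DownwardClosuresComputable) : C.SUPDecidable := by
  obtain ⟨f, hf, hf'⟩ := hC
  let R : List ℕ × (List ℕ × ℕ) → Bool → Prop := fun x b => ∃ A, A ∈ f x.2 ∧
    ((b = true ∧ Pumpable A x.1) ∨ (b = false ∧ BlockRejected A x.1))
  have hR : Enumerable fun x : (List ℕ × (List ℕ × ℕ)) × Bool => R x.1 x.2 := by
    refine .ex (.and ?_ (.or (.and (.of_primrec (primrecPred_eq (by fun_prop) (by fun_prop)))
      (enumerable_pumpable (by fun_prop) (by fun_prop))) (.and
      (.of_primrec (primrecPred_eq (by fun_prop) (by fun_prop)))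
      (enumerable_blockRejected (by fun_prop) (by fun_prop)))))
    exact (Enumerable.graph hf).comp
      (f := fun x : ((List ℕ × (List ℕ × ℕ)) × Bool) × FiniteAutomaton => (x.1.1.2, x.2))
      (by fun_prop)
  obtain ⟨g, hg, hgR, hdom⟩ := hR.exists_partrec
  refine ⟨g, hg, fun as r hr _ hL => ?_⟩
  obtain ⟨A, hA, hacc⟩ := hf' r hr
  have hpump : Pumpable A as ↔ ∀ k, blockWord as k ∈ A.accepts :=
    pumpable_iff (by rw [hacc]; exact downwardClosure_down _)
  -- One of the two searches must succeed, whatever the answer is.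
  have hd : (g (as, r)).Dom := by
    by_cases h : ∀ k, blockWord as k ∈ A.accepts
    · exact hdom _ ⟨true, A, hA, .inl ⟨rfl, hpump.2 h⟩⟩
    · exact hdom _ ⟨false, A, hA, .inr ⟨rfl, blockRejected_iff.2 (not_forall.1 h)⟩⟩
  refine ⟨_, Part.get_mem hd, ?_⟩
  rw [downwardClosure_eq_boundedStar_iff hL, ← hacc]
  obtain ⟨A', hA', h⟩ := hgR _ _ (Part.get_mem hd)
  obtain rfl := Part.mem_unique hA hA'
  rcases h with ⟨hb, h⟩ | ⟨hb, h⟩ <;> rw [hb]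
  · exact iff_of_true rfl (hpump.1 h)
  · exact iff_of_false (by simp) (not_forall.2 (blockRejected_iff.1 h))

end DownwardClosures

theorem theorem1 (C : DownwardClosures.LanguageClass) (hC : C.IsFullTrio) :
    C.DownwardClosuresComputable ↔ C.SUPDecidable :=
  ⟨DownwardClosures.LanguageClass.supDecidable_of_downwardClosuresComputable,
    DownwardClosures.LanguageClass.downwardClosuresComputable_of_supDecidable hC⟩
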